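/- Let $\mathfrak K$ be a field, let $\Gamma$ be a finite quiver without directed cycles, with vertex set $\Gamma_0$ and arrow set $\Gamma_1$, and let $\Lambda=\mathfrak K\Gamma/I$ with $I$ an admissible ideal of the path algebra. Paths are composed from right to left, $\mathrm s(\cdot)$ and $\mathrm t(\cdot)$ denote starting and end points, paths are identified with their classes in $\Lambda$, modules are finitely generated left modules, and $J$ is the Jacobson radical of $\Lambda$. A module is uniserial if it has exactly one composition series. Assume that $\Lambda$ is left multiserial, i.e. for each primitive idempotent $e$ of $\Lambda$ the left ideal $Je$ is a sum of uniserial $\Lambda$-modules. Let $U$ be a uniserial $\Lambda$-module of length $n$ with mast $p$; that is, $$p=\alpha_{n-1}\cdots\alpha_1:\ 1\xrightarrow{\alpha_1}2\xrightarrow{\alpha_2}\cdots\xrightarrow{\alpha_{n-1}}n$$ is a path in $\Gamma$ of length $n-1$ with $px\neq0$ for some $x\in U$. Put - $B=\{\beta\in\Gamma_1\mid \mathrm s(\beta)\in\{1,\dots,n-1\},\ \mathrm t(\beta)\notin\{1,\dots,n\}\}$, - $C=\{\gamma\in\Gamma_1\mid \mathrm s(\gamma)\notin\{1,\dots,n\},\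 \mathrm t(\gamma)\in\{2,\dots,n\}\}$, - $D=\{\delta\in\Gamma_1\mid \mathrm s(\delta),\mathrm t(\delta)\in\{1,\dots,n\},\ \delta\notin\{\alpha_1,\dots,\alpha_{n-1}\}\}$. Here an empty product of consecutive $\alpha$'s stands for $1$. Then the following statements are equivalent: (1) The embedding $JU\hookrightarrow U$ is irreducible; that is, it is neither a split monomorphism nor a split epimorphism, and whenever it factors as $JU\xrightarrow{\varphi}V\xrightarrow{\psi}U$ through a finitely generated $\Lambda$-module $V$, then $\varphi$ is a split monomorphism or $\psi$ is a split epimorphism. (2) $U$ is not simple, and both (a) and (b) hold: (a) $\beta\,\alpha_{\mathrm s(\beta)-1}\cdots\alpha_1\in Jp$ for every $\beta\in B$, and $\delta\,\alpha_{\mathrm s(\delta)-1}\cdots\alpha_1\in\mathfrak K\,\alpha_{\mathrm t(\delta)-1}\cdots\alpha_1$ for every $\delta\in D$. (b) There is a subset $R\subset J$ such that $\{rp+J^2p\mid r\in R\}$ is a $\mathfrak K$-basis of $Jp/J^2p$ and (i) for every $\gamma\in C$ there is $w\in pJ$ such that $r\,\alpha_{n-1}\cdots\alpha_{\mathrm t(\gamma)}\,\gamma=rw$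 for every $r\in R$; (ii) for every $\delta\in D$ and every $r\in R$, $r\,\alpha_{n-1}\cdots\alpha_{\mathrm t(\delta)}\,\delta\in\mathfrak K\,r\,\alpha_{n-1}\cdots\alpha_{\mathrm s(\delta)}$. -/

import Mathlib

open Quiver

noncomputable section

/-! ### Path algebras -/

/-- The underlying vector space of the path algebra `KΓ` of a quiver `Γ` with vertex type `Q`:
its basis is the set of all paths of `Γ` (including the trivial path at each vertex). -/
def PathAlgebra (K : Type*) [Field K] (Q : Type*) [Quiver Q] : Type _ :=
  (Σ a b : Q, Path a b) →₀ K

namespace PathAlgebra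

variable {K : Type*} [Field K] {Q : Type*} [Quiver Q]

instance : AddCommGroup (PathAlgebra K Q) :=
  inferInstanceAs (AddCommGroup ((Σ a b : Q, Path a b) →₀ K))

instance : Module K (PathAlgebra K Q) :=
  inferInstanceAs (Module K ((Σ a b : Q, Path a b) →₀ K))

/-- The basis element given by an element of the type of all paths. -/
def ofSigma (K : Type*) [Field K] {Q : Type*} [Quiver Q] (x : Σ a b : Q, Path a b) :
    PathAlgebra K Q :=
  Finsupp.single x 1

/-- The basis element of the path algebra given by the path `p`. -/
def of (K : Type*) [Field K] {Q : Type*} [Quiver Q] {a b : Q} (p : Path a b) :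
    PathAlgebra K Q :=
  ofSigma K ⟨a, b, p⟩

/-- Paths are composed from right to left: the product `x * y` of two paths is the path
"first `y`, then `x`" if `y` ends where `x` starts, and `0` otherwise. -/
def mulPath (K : Type*) [Field K] {Q : Type*} [Quiver Q] (x y : Σ a b : Q, Path a b) :
    PathAlgebra K Q :=
  open Classical in
  if h : x.1 = y.2.1 then of K (y.2.2.comp (x.2.2.cast h rfl)) else 0

/-- The linear map with prescribed values on the paths. -/
def lift {M : Type*} [AddCommGroup M] [Module K M] (f : (Σ a b : Q, Path a b) → M) :
    PathAlgebra K Q →ₗ[K] M :=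
  Finsupp.linearCombination K f

theorem lift_ofSigma {M : Type*} [AddCommGroup M] [Module K M] (f : (Σ a b : Q, Path a b) → M)
    (x : Σ a b : Q, Path a b) : lift f (ofSigma K x) = f x :=
  (Finsupp.linearCombination_single K 1 x).trans (one_smul K (f x))

/-- The bilinear extension of the product of paths. -/
def mulHom (K : Type*) [Field K] (Q : Type*) [Quiver Q] :
    PathAlgebra K Q →ₗ[K] PathAlgebra K Q →ₗ[K] PathAlgebra K Q :=
  lift fun x => lift fun y => mulPath K x y

instance : Mul (PathAlgebra K Q) := ⟨fun x y => mulHom K Q x y⟩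

/-- The unit is the sum of all trivial paths. -/
instance [Fintype Q] : One (PathAlgebra K Q) := ⟨∑ v : Q, of K (Path.nil : Path v v)⟩

theorem mul_def (x y : PathAlgebra K Q) : x * y = mulHom K Q x y := rfl

theorem one_def [Fintype Q] : (1 : PathAlgebra K Q) = ∑ v : Q, of K (Path.nil : Path v v) := rfl

theorem mulHom_ofSigma (x y : Σ a b : Q, Path a b) :
    mulHom K Q (ofSigma K x) (ofSigma K y) = mulPath K x y := by
  rw [mulHom, lift_ofSigma, lift_ofSigma]

theorem of_mul_of {a b c : Q} (p : Path a b) (q : Path b c) :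
    of K q * of K p = of K (p.comp q) := by
  rw [mul_def, of, of, mulHom_ofSigma, mulPath, dif_pos rfl]
  rfl

theorem of_mul_of_ne {a b c d : Q} (p : Path a b) (q : Path c d) (h : c ≠ b) :
    of K q * of K p = 0 := by
  rw [mul_def, of, of, mulHom_ofSigma, mulPath, dif_neg h]

theorem hom_ext {M : Type*} [AddCommGroup M] [Module K M] {f g : PathAlgebra K Q →ₗ[K] M}
    (h : ∀ (a b : Q) (p : Path a b), f (of K p) = g (of K p)) : f = g :=
  Finsupp.lhom_ext' fun x => LinearMap.ext_ring (h x.1 x.2.1 x.2.2)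

theorem mulHom_assoc (x y z : PathAlgebra K Q) :
    mulHom K Q (mulHom K Q x y) z = mulHom K Q x (mulHom K Q y z) := by
  have h1 : (mulHom K Q).flip z ∘ₗ (mulHom K Q).flip y = (mulHom K Q).flip (mulHom K Q y z) := by
    refine hom_ext fun a b p => ?_
    have h2 : (mulHom K Q).flip z ∘ₗ mulHom K Q (of K p) =
        mulHom K Q (of K p) ∘ₗ (mulHom K Q).flip z := by
      refine hom_ext fun c d q => ?_
      have h3 : mulHom K Q (mulHom K Q (of K p) (of K q)) =
          mulHom K Q (of K p) ∘ₗ mulHom K Q (of K q) := by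
        refine hom_ext fun e f r => ?_
        change (of K p * of K q) * of K r = of K p * (of K q * of K r)
        by_cases h1 : a = d
        · subst h1
          by_cases h2 : c = f
          · subst h2
            simp only [of_mul_of, Path.comp_assoc]
          · rw [of_mul_of, of_mul_of_ne _ _ h2, of_mul_of_ne _ _ h2]
            exact (map_zero (mulHom K Q (of K p))).symm
        · rw [of_mul_of_ne _ _ h1]
          by_cases h2 : c = f
          · subst h2
            rw [of_mul_of, of_mul_of_ne _ _ h1]
            exact LinearMap.congr_fun (map_zero (mulHom K Q)) (of K r)
          · rw [of_mul_of_ne _ _ h2]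
            refine (LinearMap.congr_fun (map_zero (mulHom K Q)) (of K r)).trans ?_
            exact (map_zero (mulHom K Q (of K p))).symm
      exact LinearMap.congr_fun h3 z
    exact LinearMap.congr_fun h2 y
  exact LinearMap.congr_fun h1 x

theorem one_mulHom [Fintype Q] (x : PathAlgebra K Q) : mulHom K Q 1 x = x := by
  classical
  suffices h : mulHom K Q 1 = LinearMap.id from LinearMap.congr_fun h x
  refine hom_ext fun a b p => ?_
  rw [one_def, map_sum, LinearMap.sum_apply, Finset.sum_eq_single b]
  · exact of_mul_of p Path.nil
  · intro c _ hc
    exact of_mul_of_ne _ _ hc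
  · intro h
    exact absurd (Finset.mem_univ b) h

theorem mulHom_one [Fintype Q] (x : PathAlgebra K Q) : mulHom K Q x 1 = x := by
  classical
  suffices h : (mulHom K Q).flip 1 = LinearMap.id from LinearMap.congr_fun h x
  refine hom_ext fun a b p => ?_
  rw [LinearMap.flip_apply, one_def, map_sum, Finset.sum_eq_single a]
  · exact (of_mul_of Path.nil p).trans (by rw [Path.nil_comp]; rfl)
  · intro c _ hc
    exact of_mul_of_ne _ _ hc.symm
  · intro h
    exact absurd (Finset.mem_univ a) h

instance [Fintype Q] : Ring (PathAlgebra K Q) :=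
  { (inferInstance : AddCommGroup (PathAlgebra K Q)),
    (inferInstance : Mul (PathAlgebra K Q)),
    (inferInstance : One (PathAlgebra K Q)) with
    left_distrib := fun x y z => map_add (mulHom K Q x) y z
    right_distrib := fun x y z => LinearMap.congr_fun (map_add (mulHom K Q) x y) z
    zero_mul := fun x => LinearMap.congr_fun (map_zero (mulHom K Q)) x
    mul_zero := fun x => map_zero (mulHom K Q x)
    mul_assoc := mulHom_assoc
    one_mul := one_mulHom
    mul_one := mulHom_one }

instance [Fintype Q] : Algebra K (PathAlgebra K Q) :=
  Algebra.ofModule (fun c x y => LinearMap.congr_fun (map_smul (mulHom K Q) c x) y)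
    (fun c x y => map_smul (mulHom K Q x) c y)

/-- The span of all paths of length at least `m`: the `m`-th power of the ideal of `KΓ` that is
generated by the arrows. -/
def arrowIdealPow (K : Type*) [Field K] (Q : Type*) [Quiver Q] (m : ℕ) :
    Submodule K (PathAlgebra K Q) :=
  Submodule.span K {x | ∃ (a b : Q) (p : Path a b), m ≤ p.length ∧ x = of K p}

end PathAlgebra

/-- The quiver has no directed cycles. -/
def QuiverIsAcyclic (Q : Type*) [Quiver Q] : Prop :=
  ∀ (a : Q) (p : Path a a), p.length = 0

/-- `π : KΓ → Λ` presents `Λ` as a quotient `KΓ/I` by an admissible ideal `I = ker π`, that is,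
`F ^ m ⊆ I ⊆ F ^ 2` for some `m ≥ 2`, where `F` is the ideal generated by the arrows. -/
def IsAdmissiblePresentation {K : Type*} [Field K] {Q : Type*} [Quiver Q] [Fintype Q]
    {Λ : Type*} [Ring Λ] [Algebra K Λ] (π : PathAlgebra K Q →ₐ[K] Λ) : Prop :=
  Function.Surjective π ∧
  LinearMap.ker π.toLinearMap ≤ PathAlgebra.arrowIdealPow K Q 2 ∧
  ∃ m : ℕ, 2 ≤ m ∧ PathAlgebra.arrowIdealPow K Q m ≤ LinearMap.ker π.toLinearMap

/-! ### Modules -/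

/-- A module is uniserial if it has exactly one composition series. -/
def IsUniserial (R : Type*) [Ring R] (M : Type*) [AddCommGroup M] [Module R M] : Prop :=
  ∃! s : CompositionSeries (Submodule R M), s.head = ⊥ ∧ s.last = ⊤

/-- The radical `JM` of a module `M`, where `J` is the Jacobson radical of the ring. -/
def radicalSubmodule (R : Type*) [Ring R] (M : Type*) [AddCommGroup M] [Module R M] :
    Submodule R M :=
  Ring.jacobson R • (⊤ : Submodule R M)

def IsSplitMonomorphism {R : Type*} [Ring R] {M N : Type*} [AddCommGroup M] [Module R M]
    [AddCommGroup N] [Module R N] (f : M →ₗ[R] N) : Prop :=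
  ∃ g : N →ₗ[R] M, g ∘ₗ f = LinearMap.id

def IsSplitEpimorphism {R : Type*} [Ring R] {M N : Type*} [AddCommGroup M] [Module R M]
    [AddCommGroup N] [Module R N] (f : M →ₗ[R] N) : Prop :=
  ∃ g : N →ₗ[R] M, f ∘ₗ g = LinearMap.id

/-- Irreducible maps in the category of finitely generated left modules. Every finitely generated
`R`-module is isomorphic to one in the universe of `R`, so that the middle terms may be taken
there. -/
def IsIrreducibleMap.{u, v, w} {R : Type u} [Ring R] {M : Type v} {N : Type w} [AddCommGroup M] [Module R M]
    [AddCommGroup N] [Module R N] (f : M →ₗ[R] N) : Prop :=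
  ¬ IsSplitMonomorphism f ∧ ¬ IsSplitEpimorphism f ∧
  ∀ (V : Type u) [AddCommGroup V] [Module R V] [Module.Finite R V]
    (φ : M →ₗ[R] V) (ψ : V →ₗ[R] N), ψ ∘ₗ φ = f →
      IsSplitMonomorphism φ ∨ IsSplitEpimorphism ψ

/-- `e` is a nonzero idempotent which is not the sum of two nonzero orthogonal idempotents. -/
def IsPrimitiveIdempotent {R : Type*} [Ring R] (e : R) : Prop :=
  IsIdempotentElem e ∧ e ≠ 0 ∧
  ∀ f g : R, IsIdempotentElem f → IsIdempotentElem g → f * g = 0 → g * f = 0 → e = f + g →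
    f = 0 ∨ g = 0

/-- For every primitive idempotent `e`, the left ideal `Je = {j * e | j ∈ J}` is a sum of uniserial
modules. -/
def IsLeftMultiserial (R : Type*) [Ring R] : Prop :=
  ∀ e : R, IsPrimitiveIdempotent e →
    ∃ S : Set (Submodule R R), (∀ N ∈ S, IsUniserial R N) ∧
      sSup S = (Ring.jacobson R).map (LinearMap.toSpanSingleton R R e)

/-! ### Masts and the combinatorial conditions -/

section Conditions

variable {K : Type*} [Field K] {Q : Type*} [Quiver Q] [Fintype Q]
  {Λ : Type*} [Ring Λ] [Algebra K Λ]

/-- The class in `Λ` of a path of the quiver. -/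
def pathClass (π : PathAlgebra K Q →ₐ[K] Λ) {a b : Q} (p : Path a b) : Λ :=
  π (PathAlgebra.of K p)

/-- `p` is a mast of `U`: its length is one less than the (finite) length of `U`, and `p` does not
annihilate `U`. -/
def IsMast (π : PathAlgebra K Q →ₐ[K] Λ) {a b : Q} (p : Path a b)
    (U : Type*) [AddCommGroup U] [Module Λ U] : Prop :=
  Module.length Λ U = p.length + 1 ∧ ∃ x : U, pathClass π p • x ≠ 0

/-- The arrow `δ` is one of the arrows of the path `p`. -/
def IsArrowOf {a b i j : Q} (δ : i ⟶ j) (p : Path a b) : Prop :=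
  ∃ (u : Path a i) (w : Path j b), p = (u.cons δ).comp w

/-- `L z = {l * z | l ∈ L}`, for a left ideal `L`, as a `K`-subspace of `Λ`. -/
def leftTimes (K : Type*) [Field K] {Λ : Type*} [Ring Λ] [Algebra K Λ] (L : Ideal Λ) (z : Λ) :
    Submodule K Λ :=
  (L.restrictScalars K).map (LinearMap.mulRight K z)

/-- `z L = {z * l | l ∈ L}`, as a `K`-subspace of `Λ`. -/
def timesLeft (K : Type*) [Field K] {Λ : Type*} [Ring Λ] [Algebra K Λ] (z : Λ) (L : Ideal Λ) :
    Submodule K Λ :=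
  (L.restrictScalars K).map (LinearMap.mulLeft K z)

/-- The condition on initial subpaths of `p`.
First part: for every arrow `β : i ⟶ j` with `i` a vertex of `p` other than its end point, and `j`
not a vertex of `p`, the path "`p` up to `i`, then `β`" lies in `Jp`.
Second part: for every arrow `δ : i ⟶ j` between vertices of `p` which is not an arrow of `p`, the
path "`p` up to `i`, then `δ`" is a scalar multiple of "`p` up to `j`".
When there are no directed cycles, the decompositions `p = u.comp w` are determined by the vertex
at which `p` is cut. -/
def ConditionA (π : PathAlgebra K Q →ₐ[K] Λ) {a b : Q} (p : Path a b) : Prop :=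
  (∀ (i j : Q) (β : i ⟶ j) (u : Path a i) (w : Path i b), p = u.comp w → i ≠ b →
    j ∉ p.vertices →
      pathClass π (u.cons β) ∈ leftTimes K (Ring.jacobson Λ) (pathClass π p)) ∧
  (∀ (i j : Q) (δ : i ⟶ j) (u : Path a i) (w : Path i b) (u' : Path a j) (w' : Path j b),
    p = u.comp w → p = u'.comp w' → ¬ IsArrowOf δ p →
      pathClass π (u.cons δ) ∈ Submodule.span K {pathClass π u'})

/-- For a subset `R` of `J`: the set `{rp + J²p | r ∈ R}` is a `K`-basis of `Jp/J²p`
(regarded as a subspace of `Λ/J²p`). -/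
def IsBasisModJSq (K : Type*) [Field K] {Λ : Type*} [Ring Λ] [Algebra K Λ]
    (R : Set Λ) (p : Λ) : Prop :=
  let q := (leftTimes K (Ring.jacobson Λ ^ 2) p).mkQ
  let S : Set (Λ ⧸ leftTimes K (Ring.jacobson Λ ^ 2) p) := {y | ∃ r ∈ R, y = q (r * p)}
  LinearIndepOn K id S ∧ Submodule.span K S = (leftTimes K (Ring.jacobson Λ) p).map q

/-- The condition on terminal subpaths of `p`. There is `R ⊆ J` such that `{rp + J²p | r ∈ R}` is a
`K`-basis of `Jp/J²p` and:
(i) for every arrow `γ : i ⟶ j` with `i` not a vertex of `p`, and `j` a vertex of `p` other than its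
starting point, there is `w ∈ pJ` such that `r * (γ, then p from j on) = r * w` for all `r ∈ R`;
(ii) for every arrow `δ : i ⟶ j` between vertices of `p` which is not an arrow of `p`, and every
`r ∈ R`, the element `r * (δ, then p from j on)` is a scalar multiple of `r * (p from i on)`. -/
def ConditionB (π : PathAlgebra K Q →ₐ[K] Λ) {a b : Q} (p : Path a b) : Prop :=
  ∃ R : Set Λ, R ⊆ (Ring.jacobson Λ : Set Λ) ∧ IsBasisModJSq K R (pathClass π p) ∧
    (∀ (i j : Q) (γ : i ⟶ j) (u' : Path a j) (w' : Path j b), p = u'.comp w' → j ≠ a →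
      i ∉ p.vertices →
        ∃ w ∈ timesLeft K (pathClass π p) (Ring.jacobson Λ),
          ∀ r ∈ R, r * pathClass π (γ.toPath.comp w') = r * w) ∧
    (∀ (i j : Q) (δ : i ⟶ j) (u : Path a i) (w : Path i b) (u' : Path a j) (w' : Path j b),
      p = u.comp w → p = u'.comp w' → ¬ IsArrowOf δ p →
        ∀ r ∈ R, r * pathClass π (δ.toPath.comp w') ∈ Submodule.span K {r * pathClass π w})

end Conditions

end

/-!
In an acyclic quiver, every vertex space `e_i U` of `U` is `K u_i x`, where `x` is a top element of
`U` and `u_i` is the initial subpath of the mast `p` that ends at `i`. Writing `e_a` and `e_b` for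
the end points of `p`, the embedding `JU ↪ U` is irreducible if and only if `U ≅ Λ e_a / Jp` and,
for some `R ⊆ J` that represents a basis of `Jp / J²p`, every element of `e_b Ann(U)` agrees with
an element of `pJ` up to the right annihilator of `R`. Conditions (a) and (b) say the same arrow by
arrow, because the elements that satisfy them are stable under multiplication by arrows.

If the embedding is irreducible, it factors through the pullback of `U → U / JU` and any
`V → U / JU`, so that either `V → U / JU` lifts to `U`, or `U → U / JU` factors through `V`. For
`V = (Λ × Λ^T) / Λ (p, τ)`, with `τ` listing generators of `e_b Ann(U)`, there is no lift, as it
would give a top element killed by `p`; the factorization yields both halves of the criterion.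

Conversely, let `ψ ∘ φ` be a factorization of the embedding through `V`, and `ψ y = x`. If `p y`
lies in `Y = p ψ⁻¹(JU) + {z | R z ⊆ im φ}`, then `y` can be chosen so that `Jp y = 0`, and `x ↦ y`
splits `ψ`. Otherwise some functional `f` has `f (p y) = 1` and `f Y = 0`. Since `soc U = K p x`, it
induces a homomorphism `g : V → U` with `p g(v) = f (p v) p x`, and `ψ - g` is a retraction onto
`JU`.
-/

namespace QuiverIsAcyclic

variable {Q : Type*} [Quiver Q] (hQ : QuiverIsAcyclic Q)

include hQ

theorem isEmpty_path {i j : Q} (u : Path i j) (hij : i ≠ j) : IsEmpty (Path j i) := by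
  refine ⟨fun v => hij (Path.eq_of_length_zero u ?_)⟩
  have h := hQ i (u.comp v)
  rw [Path.length_comp] at h
  omega

theorem ne_of_hom {i j : Q} (ε : i ⟶ j) : i ≠ j := by
  rintro rfl
  simpa using hQ i ε.toPath

theorem nodup_vertices {a b : Q} (p : Path a b) : p.vertices.Nodup := by
  induction p with
  | nil => simp
  | cons p ε ih =>
    rw [Path.vertices_cons, List.nodup_concat]
    refine ⟨fun hc => ?_, ih⟩
    obtain ⟨u, w, -⟩ := Path.exists_eq_comp_of_mem_vertices p hc
    simpa using hQ _ (w.cons ε)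

theorem length_lt_card [Fintype Q] {a b : Q} (p : Path a b) : p.length < Fintype.card Q := by
  have h := (hQ.nodup_vertices p).length_le_card
  rwa [Path.vertices_length] at h

theorem comp_eq_comp {a b i : Q} {u u' : Path a i} {w w' : Path i b}
    (h : u.comp w = u'.comp w') : u = u' ∧ w = w' := by
  refine (Path.comp_inj' ?_).1 h
  have hu := Path.vertices_comp_get_length_eq u w
  obtain ⟨hl, hu'⟩ : ∃ hl, (u.comp w).vertices.get ⟨u'.length, hl⟩ = i := by
    rw [h]
    exact ⟨by simp, Path.vertices_comp_get_length_eq u' w'⟩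
  exact congrArg Fin.val ((hQ.nodup_vertices (u.comp w)).injective_get (hu.trans hu'.symm))

end QuiverIsAcyclic

theorem mem_vertices_iff_exists_comp {Q : Type*} [Quiver Q] {a b : Q} {p : Path a b} {i : Q} :
    i ∈ p.vertices ↔ ∃ (u : Path a i) (w : Path i b), p = u.comp w := by
  refine ⟨fun h => Path.exists_eq_comp_of_mem_vertices p h, ?_⟩
  rintro ⟨u, w, rfl⟩
  rw [Path.vertices_comp, List.mem_append]
  exact Or.inr (Path.start_mem_vertices w)

theorem mem_jacobson_iff_exists_mul_eq_one {R : Type*} [Ring R] {x : R} :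
    x ∈ Ring.jacobson R ↔ ∀ y, ∃ z, z * (1 + y * x) = 1 := by
  rw [← Ideal.jacobson_bot, Ideal.mem_jacobson_iff]
  simp only [Ideal.mem_bot, sub_eq_zero, mul_add, mul_one, ← mul_assoc, add_comm]

section QuotientOfPathAlgebra

variable {K : Type*} [Field K] {Q : Type*} [Quiver Q] [Fintype Q]
  {Λ : Type*} [Ring Λ] [Algebra K Λ] (π : PathAlgebra K Q →ₐ[K] Λ)

/-- The idempotent of `Λ` given by the trivial path at the vertex `v`. -/
noncomputable def vertexIdem (v : Q) : Λ := pathClass π (Path.nil : Path v v)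

theorem pathClass_mul_pathClass {a b c : Q} (p : Path a b) (q : Path b c) :
    pathClass π q * pathClass π p = pathClass π (p.comp q) := by
  rw [pathClass, pathClass, ← map_mul, PathAlgebra.of_mul_of, pathClass]

theorem pathClass_mul_pathClass_of_ne {a b c d : Q} (p : Path a b) (q : Path c d) (h : c ≠ b) :
    pathClass π q * pathClass π p = 0 := by
  rw [pathClass, pathClass, ← map_mul, PathAlgebra.of_mul_of_ne _ _ h, map_zero]

theorem pathClass_cons {a b c : Q} (p : Path a b) (ε : b ⟶ c) :
    pathClass π (p.cons ε) = pathClass π ε.toPath * pathClass π p :=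
  (pathClass_mul_pathClass π p ε.toPath).symm

theorem vertexIdem_mul_pathClass {a b : Q} (p : Path a b) :
    vertexIdem π b * pathClass π p = pathClass π p := by
  rw [vertexIdem, pathClass_mul_pathClass, Path.comp_nil]

theorem pathClass_mul_vertexIdem {a b : Q} (p : Path a b) :
    pathClass π p * vertexIdem π a = pathClass π p := by
  rw [vertexIdem, pathClass_mul_pathClass, Path.nil_comp]

theorem vertexIdem_mul_pathClass_of_ne {a b c : Q} (p : Path a b) (h : c ≠ b) :
    vertexIdem π c * pathClass π p = 0 :=
  pathClass_mul_pathClass_of_ne π _ _ h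

theorem pathClass_mul_vertexIdem_of_ne {a b c : Q} (p : Path a b) (h : a ≠ c) :
    pathClass π p * vertexIdem π c = 0 :=
  pathClass_mul_pathClass_of_ne π _ _ h

theorem vertexIdem_mul_self (v : Q) : vertexIdem π v * vertexIdem π v = vertexIdem π v :=
  vertexIdem_mul_pathClass π _

theorem vertexIdem_mul_of_ne {v w : Q} (h : v ≠ w) : vertexIdem π v * vertexIdem π w = 0 :=
  vertexIdem_mul_pathClass_of_ne π _ h

theorem sum_vertexIdem : ∑ v : Q, vertexIdem π v = 1 := by
  rw [← map_one π, PathAlgebra.one_def, map_sum]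
  rfl

theorem sum_vertexIdem_mul (l : Λ) : ∑ v : Q, vertexIdem π v * l = l := by
  rw [← Finset.sum_mul, sum_vertexIdem, one_mul]

theorem sum_mul_vertexIdem (l : Λ) : ∑ v : Q, l * vertexIdem π v = l := by
  rw [← Finset.mul_sum, sum_vertexIdem, mul_one]

theorem sum_vertexIdem_smul {M : Type*} [AddCommGroup M] [Module Λ M] (x : M) :
    ∑ v : Q, vertexIdem π v • x = x := by
  rw [← Finset.sum_smul, sum_vertexIdem, one_smul]

variable {π} (hQ : QuiverIsAcyclic Q) (hπ : Function.Surjective π)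

include hπ

theorem mem_of_forall_pathClass_mem {G : Submodule K Λ}
    (h : ∀ (i j : Q) (q : Path i j), pathClass π q ∈ G) (l : Λ) : l ∈ G := by
  obtain ⟨x, rfl⟩ := hπ l
  have hG : G.mkQ ∘ₗ π.toLinearMap = 0 :=
    PathAlgebra.hom_ext fun i j q => (Submodule.Quotient.mk_eq_zero G).2 (h i j q)
  exact (Submodule.Quotient.mk_eq_zero G).1 (LinearMap.congr_fun hG x)

theorem vertexIdem_mul_mul_vertexIdem_mem {i j : Q} {G : Submodule K Λ}
    (h : ∀ q : Path j i, pathClass π q ∈ G) (l : Λ) :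
    vertexIdem π i * l * vertexIdem π j ∈ G := by
  refine mem_of_forall_pathClass_mem hπ (G := G.comap (LinearMap.mulRight K (vertexIdem π j) ∘ₗ
    LinearMap.mulLeft K (vertexIdem π i))) (fun c d q => ?_) l
  change vertexIdem π i * pathClass π q * vertexIdem π j ∈ G
  by_cases hd : i = d
  · by_cases hc : c = j
    · subst hd hc
      rw [vertexIdem_mul_pathClass, pathClass_mul_vertexIdem]
      exact h q
    · rw [mul_assoc, pathClass_mul_vertexIdem_of_ne π q hc, mul_zero]
      exact zero_mem G
  · rw [vertexIdem_mul_pathClass_of_ne π q hd, zero_mul]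
    exact zero_mem G

theorem mul_vertexIdem_mem {G : Submodule K Λ} {a : Q} (ha : vertexIdem π a ∈ G)
    (h : ∀ (i j : Q) (ε : i ⟶ j), ∀ g ∈ G, pathClass π ε.toPath * g ∈ G) (l : Λ) :
    l * vertexIdem π a ∈ G := by
  have hpath : ∀ (i : Q) (q : Path a i), pathClass π q ∈ G := by
    intro i q
    induction q with
    | nil => exact ha
    | cons q ε ih =>
      rw [pathClass_cons]
      exact h _ _ ε _ ih
  rw [← sum_vertexIdem_mul π (l * vertexIdem π a)]
  refine sum_mem fun i _ => ?_
  rw [← mul_assoc]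
  exact vertexIdem_mul_mul_vertexIdem_mem hπ (hpath i) l

theorem vertexIdem_mul_mem {G : Submodule K Λ} {b : Q} (hb : vertexIdem π b ∈ G)
    (h : ∀ (i j : Q) (ε : i ⟶ j), ∀ g ∈ G, g * pathClass π ε.toPath ∈ G) (l : Λ) :
    vertexIdem π b * l ∈ G := by
  have hpath : ∀ (i j : Q) (q : Path i j), ∀ g ∈ G, g * vertexIdem π j = g →
      g * pathClass π q ∈ G := by
    intro i j q
    induction q with
    | nil => exact fun g hg hj => (hj.symm ▸ hg : g * vertexIdem π i ∈ G)
    | cons q ε ih =>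
      intro g hg _
      rw [pathClass_cons, ← mul_assoc]
      exact ih _ (h _ _ _ _ hg) (by rw [mul_assoc, pathClass_mul_vertexIdem])
  rw [← sum_mul_vertexIdem π (vertexIdem π b * l)]
  refine sum_mem fun i _ => vertexIdem_mul_mul_vertexIdem_mem hπ (fun q => ?_) l
  rw [← vertexIdem_mul_pathClass]
  exact hpath i b q _ hb (vertexIdem_mul_self π b)

include hQ

theorem exists_vertexIdem_mul_mul_vertexIdem_eq_smul (i : Q) (l : Λ) :
    ∃ c : K, vertexIdem π i * l * vertexIdem π i = c • vertexIdem π i := by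
  have h : vertexIdem π i * l * vertexIdem π i ∈ Submodule.span K {vertexIdem π i} := by
    refine vertexIdem_mul_mul_vertexIdem_mem hπ (fun q => ?_) l
    rw [Path.eq_nil_of_length_zero q (hQ i q)]
    exact Submodule.mem_span_singleton_self _
  exact (Submodule.mem_span_singleton.1 h).imp fun _ => Eq.symm

theorem vertexIdem_mul_mul_vertexIdem_eq_zero {i j : Q} (u : Path i j) (hij : i ≠ j) (l : Λ) :
    vertexIdem π i * l * vertexIdem π j = 0 :=
  have := hQ.isEmpty_path u hij
  (Submodule.mem_bot K).1 (vertexIdem_mul_mul_vertexIdem_mem hπ (fun q => isEmptyElim q) l)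

theorem vertexIdem_mul_mul_vertexIdem_mem_jacobson {i j : Q} (hij : i ≠ j) (l : Λ) :
    vertexIdem π i * l * vertexIdem π j ∈ Ring.jacobson Λ := by
  refine vertexIdem_mul_mul_vertexIdem_mem hπ
    (G := (Ring.jacobson Λ).restrictScalars K) (fun u => ?_) l
  refine mem_jacobson_iff_exists_mul_eq_one.2 fun y => ⟨1 - y * pathClass π u, ?_⟩
  have hu : pathClass π u * y * pathClass π u = 0 := by
    calc pathClass π u * y * pathClass π u
        = pathClass π u * (vertexIdem π j * y * vertexIdem π i) * pathClass π u := by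
          simp only [mul_assoc, vertexIdem_mul_pathClass]
          rw [← mul_assoc (pathClass π u) (vertexIdem π j), pathClass_mul_vertexIdem]
      _ = 0 := by
          rw [vertexIdem_mul_mul_vertexIdem_eq_zero hQ hπ u hij.symm, mul_zero, zero_mul]
  calc (1 - y * pathClass π u) * (1 + y * pathClass π u)
      = 1 - y * (pathClass π u * y * pathClass π u) := by noncomm_ring
    _ = 1 := by rw [hu, mul_zero, sub_zero]

theorem mem_jacobson_iff_vertexIdem {l : Λ} :
    l ∈ Ring.jacobson Λ ↔ ∀ i, vertexIdem π i * l * vertexIdem π i = 0 := by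
  constructor
  · intro hl i
    obtain ⟨c, hc⟩ := exists_vertexIdem_mul_mul_vertexIdem_eq_smul hQ hπ i l
    rcases eq_or_ne c 0 with rfl | hc0
    · rw [hc, zero_smul]
    · have hi : vertexIdem π i ∈ (Ring.jacobson Λ).restrictScalars K := by
        rw [← inv_smul_smul₀ hc0 (vertexIdem π i), ← hc]
        exact Submodule.smul_mem _ _ (Ideal.mul_mem_right _ _ (Ideal.mul_mem_left _ _ hl))
      obtain ⟨z, hz⟩ := mem_jacobson_iff_exists_mul_eq_one.1 hi (-1)
      have hi0 : vertexIdem π i = 0 := by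
        rw [← one_mul (vertexIdem π i), ← hz, mul_assoc, add_mul, neg_one_mul, one_mul, neg_mul,
          vertexIdem_mul_self, add_neg_cancel, mul_zero]
      rw [hi0, mul_zero]
  · intro h
    rw [← sum_vertexIdem_mul π l]
    refine sum_mem fun i _ => ?_
    rw [← sum_mul_vertexIdem π (vertexIdem π i * l)]
    refine sum_mem fun j _ => ?_
    rcases eq_or_ne i j with rfl | hij
    · rw [h]
      exact zero_mem _
    · exact vertexIdem_mul_mul_vertexIdem_mem_jacobson hQ hπ hij l

theorem vertexIdem_mul_mul_vertexIdem_eq_zero_of_mem_jacobson {i j : Q} (u : Path i j) {l : Λ}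
    (hl : l ∈ Ring.jacobson Λ) : vertexIdem π i * l * vertexIdem π j = 0 := by
  rcases eq_or_ne i j with rfl | hij
  · exact (mem_jacobson_iff_vertexIdem hQ hπ).1 hl i
  · exact vertexIdem_mul_mul_vertexIdem_eq_zero hQ hπ u hij l

theorem pathClass_mem_jacobson {i j : Q} (q : Path i j) (hij : i ≠ j) :
    pathClass π q ∈ Ring.jacobson Λ := by
  rw [← pathClass_mul_vertexIdem, ← vertexIdem_mul_pathClass]
  exact vertexIdem_mul_mul_vertexIdem_mem_jacobson hQ hπ hij.symm _

theorem moduleFinite_of_surjective [∀ i j : Q, Finite (i ⟶ j)] : Module.Finite K Λ := by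
  let generators : Q ⊕ (Σ i j : Q, (i ⟶ j)) → Λ :=
    Sum.elim (vertexIdem π) fun ε => pathClass π ε.2.2.toPath
  let A : Submodule K Λ := Submodule.span K (Set.range generators)
  have h_idem : ∀ v, vertexIdem π v ∈ A := fun v => Submodule.subset_span ⟨Sum.inl v, rfl⟩
  have h_one : 1 ≤ A := by
    rw [Submodule.one_le, ← sum_vertexIdem π]
    exact sum_mem fun v _ => h_idem v
  have h_path : ∀ (i j : Q) (q : Path i j), pathClass π q ∈ A ^ (q.length + 1) := by
    intro i j q
    induction q with
    | nil =>
      rw [Path.length_nil, zero_add, pow_one]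
      exact h_idem i
    | cons q ε ih =>
      rw [pathClass_cons, Path.length_cons, pow_succ']
      exact Submodule.mul_mem_mul (Submodule.subset_span ⟨Sum.inr ⟨_, _, ε⟩, rfl⟩) ih
  have h_top : A ^ Fintype.card Q = ⊤ :=
    eq_top_iff.2 fun l _ => mem_of_forall_pathClass_mem hπ
      (fun i j q => pow_le_pow_right' h_one (hQ.length_lt_card q) (h_path i j q)) l
  exact ⟨h_top ▸ (Submodule.fg_span (Set.finite_range generators)).pow _⟩

end QuotientOfPathAlgebra

section Subpaths

variable {K : Type*} [Field K] {Q : Type*} [Quiver Q] [Fintype Q]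
  {Λ : Type*} [Ring Λ] [Algebra K Λ] (π : PathAlgebra K Q →ₐ[K] Λ) {a b : Q} (p : Path a b)

open Classical in
/-- The class of the initial subpath of `p` that ends at `i`, or `0` if `i` is not on `p`. In the
absence of directed cycles there is at most one such subpath. -/
noncomputable def initialPart (i : Q) : Λ :=
  if h : ∃ (u : Path a i) (w : Path i b), p = u.comp w then pathClass π h.choose else 0

open Classical in
/-- The class of the terminal subpath of `p` that starts at `i`, or `0` if `i` is not on `p`. -/
noncomputable def terminalPart (i : Q) : Λ :=
  if h : ∃ (w : Path i b) (u : Path a i), p = u.comp w then pathClass π h.choose else 0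

variable {π p}

theorem initialPart_of_notMem {i : Q} (h : i ∉ p.vertices) : initialPart π p i = 0 :=
  dif_neg fun h' => h (mem_vertices_iff_exists_comp.2 h')

theorem terminalPart_of_notMem {i : Q} (h : i ∉ p.vertices) : terminalPart π p i = 0 :=
  dif_neg fun ⟨w, u, h'⟩ => h (mem_vertices_iff_exists_comp.2 ⟨u, w, h'⟩)

variable (hQ : QuiverIsAcyclic Q)

include hQ

theorem initialPart_eq {i : Q} {u : Path a i} {w : Path i b} (h : p = u.comp w) :
    initialPart π p i = pathClass π u := by
  have h' : ∃ (u : Path a i) (w : Path i b), p = u.comp w := ⟨u, w, h⟩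
  rw [initialPart, dif_pos h']
  obtain ⟨w', hw'⟩ := h'.choose_spec
  exact congrArg _ (hQ.comp_eq_comp (hw'.symm.trans h)).1

theorem terminalPart_eq {i : Q} {u : Path a i} {w : Path i b} (h : p = u.comp w) :
    terminalPart π p i = pathClass π w := by
  have h' : ∃ (w : Path i b) (u : Path a i), p = u.comp w := ⟨w, u, h⟩
  rw [terminalPart, dif_pos h']
  obtain ⟨u', hu'⟩ := h'.choose_spec
  exact congrArg _ (hQ.comp_eq_comp (hu'.symm.trans h)).2

theorem initialPart_start : initialPart π p a = vertexIdem π a :=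
  initialPart_eq hQ (Path.nil_comp p).symm

theorem initialPart_end : initialPart π p b = pathClass π p :=
  initialPart_eq hQ (Path.comp_nil p).symm

theorem terminalPart_start : terminalPart π p a = pathClass π p :=
  terminalPart_eq hQ (Path.nil_comp p).symm

theorem terminalPart_end : terminalPart π p b = vertexIdem π b :=
  terminalPart_eq hQ (Path.comp_nil p).symm

theorem vertexIdem_mul_initialPart (i : Q) :
    vertexIdem π i * initialPart π p i = initialPart π p i := by
  by_cases h : i ∈ p.vertices
  · obtain ⟨u, w, h⟩ := mem_vertices_iff_exists_comp.1 h
    rw [initialPart_eq hQ h, vertexIdem_mul_pathClass]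
  · rw [initialPart_of_notMem h, mul_zero]

theorem initialPart_mul_vertexIdem (i : Q) :
    initialPart π p i * vertexIdem π a = initialPart π p i := by
  by_cases h : i ∈ p.vertices
  · obtain ⟨u, w, h⟩ := mem_vertices_iff_exists_comp.1 h
    rw [initialPart_eq hQ h, pathClass_mul_vertexIdem]
  · rw [initialPart_of_notMem h, zero_mul]

theorem vertexIdem_mul_terminalPart (i : Q) :
    vertexIdem π b * terminalPart π p i = terminalPart π p i := by
  by_cases h : i ∈ p.vertices
  · obtain ⟨u, w, h⟩ := mem_vertices_iff_exists_comp.1 h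
    rw [terminalPart_eq hQ h, vertexIdem_mul_pathClass]
  · rw [terminalPart_of_notMem h, mul_zero]

theorem terminalPart_mul_vertexIdem (i : Q) :
    terminalPart π p i * vertexIdem π i = terminalPart π p i := by
  by_cases h : i ∈ p.vertices
  · obtain ⟨u, w, h⟩ := mem_vertices_iff_exists_comp.1 h
    rw [terminalPart_eq hQ h, pathClass_mul_vertexIdem]
  · rw [terminalPart_of_notMem h, zero_mul]

theorem terminalPart_mul_initialPart {i : Q} (h : i ∈ p.vertices) :
    terminalPart π p i * initialPart π p i = pathClass π p := by
  obtain ⟨u, w, h⟩ := mem_vertices_iff_exists_comp.1 h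
  rw [initialPart_eq hQ h, terminalPart_eq hQ h, pathClass_mul_pathClass, ← h]

theorem terminalPart_mul_initialPart_of_ne {i j : Q} (h : i ≠ j) :
    terminalPart π p i * initialPart π p j = 0 := by
  rw [← terminalPart_mul_vertexIdem hQ, ← vertexIdem_mul_initialPart hQ, mul_assoc,
    ← mul_assoc (vertexIdem π i), vertexIdem_mul_of_ne π h, zero_mul, mul_zero]

theorem initialPart_mem_jacobson (hπ : Function.Surjective π) {i : Q} (hi : i ≠ a) :
    initialPart π p i ∈ Ring.jacobson Λ := by
  rw [← initialPart_mul_vertexIdem hQ, ← vertexIdem_mul_initialPart hQ]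
  exact vertexIdem_mul_mul_vertexIdem_mem_jacobson hQ hπ hi _

theorem vertexIdem_mul_mul_initialPart (hπ : Function.Surjective π) {l : Λ}
    (hl : l ∈ Ring.jacobson Λ) (i : Q) : vertexIdem π a * l * initialPart π p i = 0 := by
  by_cases h : i ∈ p.vertices
  · obtain ⟨u, -, -⟩ := mem_vertices_iff_exists_comp.1 h
    rw [← vertexIdem_mul_initialPart hQ, ← mul_assoc,
      vertexIdem_mul_mul_vertexIdem_eq_zero_of_mem_jacobson hQ hπ u hl, zero_mul]
  · rw [initialPart_of_notMem h, mul_zero]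

theorem pathClass_mul_mul_initialPart (hπ : Function.Surjective π) {l : Λ}
    (hl : l ∈ Ring.jacobson Λ) (i : Q) : pathClass π p * l * initialPart π p i = 0 := by
  rw [← pathClass_mul_vertexIdem, mul_assoc (pathClass π p), mul_assoc (pathClass π p),
    vertexIdem_mul_mul_initialPart hQ hπ hl, mul_zero]

variable {M : Type*} [AddCommGroup M] [Module K M] [Module Λ M] [IsScalarTower K Λ M]

theorem terminalPart_smul_sum {i : Q} (hi : i ∈ p.vertices) (c : Q → K) (x : M) :
    terminalPart π p i • ∑ j, c j • initialPart π p j • x = c i • pathClass π p • x := by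
  rw [Finset.smul_sum, Finset.sum_eq_single i]
  · rw [smul_comm, ← mul_smul, terminalPart_mul_initialPart hQ hi]
  · intro j _ hj
    rw [smul_comm, ← mul_smul, terminalPart_mul_initialPart_of_ne hQ hj.symm, zero_smul, smul_zero]
  · exact fun h => absurd (Finset.mem_univ i) h

theorem linearIndepOn_initialPart_smul {x : M} (hx : pathClass π p • x ≠ 0) :
    LinearIndepOn K (fun i => initialPart π p i • x) {i | i ∈ p.vertices} := by
  classical
  rw [← List.coe_toFinset, linearIndepOn_finset_iff]
  intro c hc i hi
  have hsum : ∑ j, c j • initialPart π p j • x = 0 := by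
    rw [← Finset.sum_subset (Finset.subset_univ p.vertices.toFinset) fun j _ hj => ?_, hc]
    rw [initialPart_of_notMem fun h => hj (List.mem_toFinset.2 h), zero_smul, smul_zero]
  have hcx := terminalPart_smul_sum (π := π) hQ (List.mem_toFinset.1 hi) c x
  rw [hsum, smul_zero] at hcx
  exact (smul_eq_zero.1 hcx.symm).resolve_right hx

end Subpaths

section Dimension

variable {R M : Type*} [Ring R] [AddCommGroup M] [Module R M]

theorem smul_mem_radicalSubmodule {r : R} (hr : r ∈ Ring.jacobson R) (m : M) :
    r • m ∈ radicalSubmodule R M :=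
  Submodule.smul_mem_smul hr Submodule.mem_top

variable (R M) in
theorem radicalSubmodule_eq_bot [IsSemisimpleModule R M] : radicalSubmodule R M = ⊥ :=
  le_bot_iff.1 <| (Ring.jacobson_smul_top_le R M).trans_eq (IsSemisimpleModule.jacobson_eq_bot R M)

theorem IsIrreducibleMap.not_isSimpleModule
    (hirr : IsIrreducibleMap (radicalSubmodule R M).subtype) : ¬ IsSimpleModule R M := by
  intro hM
  refine hirr.1 ⟨0, LinearMap.ext fun z => Subtype.ext ?_⟩
  have hz : (z : M) ∈ (⊥ : Submodule R M) := radicalSubmodule_eq_bot R M ▸ z.2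
  exact ((Submodule.mem_bot R).1 hz).symm

variable {K : Type*} [Field K] {Q : Type*} [Quiver Q] [Fintype Q]
  {Λ : Type*} [Ring Λ] [Algebra K Λ] {π : PathAlgebra K Q →ₐ[K] Λ}
  (hQ : QuiverIsAcyclic Q) (hπ : Function.Surjective π)

include hQ hπ

theorem finrank_eq_one_of_isSimpleModule {S : Type*} [AddCommGroup S] [Module K S] [Module Λ S]
    [IsScalarTower K Λ S] [IsSimpleModule Λ S] : Module.finrank K S = 1 := by
  have : Nontrivial S := IsSimpleModule.nontrivial Λ S
  obtain ⟨x, hx⟩ := exists_ne (0 : S)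
  obtain ⟨v, hv⟩ : ∃ v : Q, vertexIdem π v • x ≠ 0 := by
    by_contra! h
    exact hx (by rw [← sum_vertexIdem_smul π x, Finset.sum_eq_zero fun v _ => h v])
  have hJ : ∀ r ∈ Ring.jacobson Λ, ∀ y : S, r • y = 0 := fun r hr y => by
    simpa only [radicalSubmodule_eq_bot, Submodule.mem_bot] using smul_mem_radicalSubmodule hr y
  refine finrank_eq_one _ hv fun z => ?_
  obtain ⟨l, rfl⟩ := IsSimpleModule.toSpanSingleton_surjective Λ hv z
  obtain ⟨c, hc⟩ := exists_vertexIdem_mul_mul_vertexIdem_eq_smul hQ hπ v l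
  refine ⟨c, ?_⟩
  calc c • vertexIdem π v • x
      = (vertexIdem π v * l * vertexIdem π v) • x := by rw [hc, smul_assoc]
    _ = ∑ w, (vertexIdem π w * l * vertexIdem π v) • x := by
        rw [Finset.sum_eq_single v (fun w _ hw => ?_) fun h => absurd (Finset.mem_univ v) h]
        exact hJ _ (vertexIdem_mul_mul_vertexIdem_mem_jacobson hQ hπ hw l) x
    _ = l • vertexIdem π v • x := by
        simp only [mul_smul]
        exact sum_vertexIdem_smul π _

theorem length_eq_finrank_of_isFiniteLength {M : Type*} [AddCommGroup M] [Module Λ M]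
    (h : IsFiniteLength Λ M) : ∀ [Module K M] [IsScalarTower K Λ M],
      Module.Finite K M ∧ Module.length Λ M = Module.finrank K M := by
  induction h with
  | of_subsingleton =>
    intro _ _
    exact ⟨inferInstance, by
      rw [Module.length_eq_zero, Module.finrank_zero_of_subsingleton, Nat.cast_zero]⟩
  | @of_simple_quotient M _ _ N _ _ ih =>
    intro _ _
    obtain ⟨_, hN⟩ : Module.Finite K (N.restrictScalars K) ∧ _ := ih
    have hquot : Module.finrank K (M ⧸ N.restrictScalars K) = 1 :=
      finrank_eq_one_of_isSimpleModule (S := M ⧸ N) hQ hπ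
    have : Module.Finite K (M ⧸ N.restrictScalars K) := Module.finite_of_finrank_eq_succ hquot
    have : Module.Finite K M := Module.Finite.of_submodule_quotient (N.restrictScalars K)
    refine ⟨this, ?_⟩
    have hlength := Module.length_eq_add_of_exact N.subtype N.mkQ N.subtype_injective
      N.mkQ_surjective (LinearMap.exact_subtype_mkQ N)
    rw [hlength, Module.length_eq_one Λ (M ⧸ N), hN,
      ← (N.restrictScalars K).finrank_quotient_add_finrank, hquot, add_comm]
    rfl

end Dimension

section Mast

variable {K : Type*} [Field K] {Q : Type*} [Quiver Q] [Fintype Q]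
  {Λ : Type*} [Ring Λ] [Algebra K Λ] (π : PathAlgebra K Q →ₐ[K] Λ) {a b : Q} (p : Path a b)

/-- `x` is a top element of a module with mast `p`: it belongs to the starting point of `p`, is not
annihilated by `p`, and its multiples by the initial subpaths of `p` span the module over `K`. -/
structure IsMastGenerator {U : Type*} [AddCommGroup U] [Module K U] [Module Λ U] (x : U) :
    Prop where
  smul_ne_zero : pathClass π p • x ≠ 0
  vertexIdem_smul : vertexIdem π a • x = x
  span_eq_top : Submodule.span K (Set.range fun i => initialPart π p i • x) = ⊤

variable {π p} {U : Type*} [AddCommGroup U] [Module Λ U]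

namespace IsMast

variable (h : IsMast π p U)
include h

theorem isFiniteLength : IsFiniteLength Λ U :=
  Module.length_ne_top_iff.1 (h.1 ▸ mod_cast ENat.natCast_ne_top (p.length + 1))

theorem isSimpleModule_iff (hQ : QuiverIsAcyclic Q) : IsSimpleModule Λ U ↔ a = b := by
  rw [← Module.length_eq_one_iff, h.1]
  constructor
  · intro hp
    exact p.eq_of_length_zero (by simpa using hp)
  · rintro rfl
    rw [hQ a p, Nat.cast_zero, zero_add]

theorem exists_isMastGenerator (hQ : QuiverIsAcyclic Q) (hπ : Function.Surjective π)
    [Module K U] [IsScalarTower K Λ U] : ∃ x : U, IsMastGenerator π p x := by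
  classical
  obtain ⟨_, hfinrank⟩ := length_eq_finrank_of_isFiniteLength (K := K) hQ hπ h.isFiniteLength
  obtain ⟨hlength, y, hy⟩ := h
  have hx : pathClass π p • vertexIdem π a • y ≠ 0 := by
    rwa [← mul_smul, pathClass_mul_vertexIdem]
  refine ⟨vertexIdem π a • y, hx, by rw [← mul_smul, vertexIdem_mul_self], ?_⟩
  have hindep := (List.coe_toFinset p.vertices ▸
    linearIndepOn_initialPart_smul hQ hx : LinearIndepOn K _ (p.vertices.toFinset : Set Q))
  have hcard : Fintype.card p.vertices.toFinset = Module.finrank K U := by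
    rw [Fintype.card_coe, List.toFinset_card_of_nodup (hQ.nodup_vertices p), Path.vertices_length]
    exact_mod_cast hlength.symm.trans hfinrank
  rw [eq_top_iff, ← hindep.linearIndependent.span_eq_top_of_card_eq_finrank' hcard]
  exact Submodule.span_mono (Set.range_comp_subset_range Subtype.val fun i => _ • _)

end IsMast

namespace IsMastGenerator

variable [Module K U] {x : U} (h : IsMastGenerator π p x)
include h

theorem exists_eq_sum (u : U) : ∃ c : Q → K, ∑ i, c i • initialPart π p i • x = u :=
  (Submodule.mem_span_range_iff_exists_fun K).1 (h.span_eq_top ▸ Submodule.mem_top)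

variable [IsScalarTower K Λ U]

theorem exists_smul_eq (u : U) : ∃ l : Λ, l • x = u := by
  obtain ⟨c, rfl⟩ := h.exists_eq_sum u
  exact ⟨∑ i, c i • initialPart π p i, by simp only [Finset.sum_smul, smul_assoc]⟩

variable (hQ : QuiverIsAcyclic Q)
include hQ

theorem smul_initialPart_eq_zero_of_terminalPart_smul {c : Q → K} {i : Q}
    (hc : terminalPart π p i • ∑ j, c j • initialPart π p j • x = 0) :
    c i • initialPart π p i = 0 := by
  by_cases hi : i ∈ p.vertices
  · rw [terminalPart_smul_sum hQ hi, smul_eq_zero_iff_left h.smul_ne_zero] at hc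
    rw [hc, zero_smul]
  · rw [initialPart_of_notMem hi, smul_zero]

theorem eq_zero_of_terminalPart_smul {u : U} (hu : ∀ i, terminalPart π p i • u = 0) : u = 0 := by
  obtain ⟨c, rfl⟩ := h.exists_eq_sum u
  refine Finset.sum_eq_zero fun i _ => ?_
  rw [← smul_assoc, h.smul_initialPart_eq_zero_of_terminalPart_smul hQ (hu i), zero_smul]

theorem vertexIdem_smul_eq (i : Q) (u : U) :
    ∃ c : K, vertexIdem π i • u = c • initialPart π p i • x := by
  obtain ⟨c, rfl⟩ := h.exists_eq_sum u
  refine ⟨c i, ?_⟩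
  rw [Finset.smul_sum, Finset.sum_eq_single i]
  · rw [smul_comm, ← mul_smul, vertexIdem_mul_initialPart hQ]
  · intro j _ hj
    rw [← vertexIdem_mul_initialPart hQ, smul_comm, ← mul_smul, ← mul_assoc,
      vertexIdem_mul_of_ne π hj.symm, zero_mul, zero_smul, smul_zero]
  · exact fun h => absurd (Finset.mem_univ i) h

theorem vertexIdem_smul_of_notMem {i : Q} (hi : i ∉ p.vertices) (u : U) :
    vertexIdem π i • u = 0 := by
  obtain ⟨c, hc⟩ := h.vertexIdem_smul_eq hQ i u
  rw [hc, initialPart_of_notMem hi, zero_smul, smul_zero]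

variable (hπ : Function.Surjective π)
include hπ

theorem vertexIdem_smul_eq_zero {z : U} (hz : z ∈ radicalSubmodule Λ U) :
    vertexIdem π a • z = 0 := by
  refine Submodule.smul_induction_on hz (fun r hr u _ => ?_) (fun y z hy hz => ?_)
  · obtain ⟨c, rfl⟩ := h.exists_eq_sum u
    rw [Finset.smul_sum, Finset.smul_sum]
    refine Finset.sum_eq_zero fun i _ => ?_
    rw [smul_comm r, smul_comm _ (c i), ← mul_smul, ← mul_smul,
      vertexIdem_mul_mul_initialPart hQ hπ hr, zero_smul, smul_zero]
  · rw [smul_add, hy, hz, add_zero]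

theorem pathClass_smul_eq_zero {z : U} (hz : z ∈ radicalSubmodule Λ U) :
    pathClass π p • z = 0 := by
  rw [← pathClass_mul_vertexIdem, mul_smul, h.vertexIdem_smul_eq_zero hQ hπ hz, smul_zero]

theorem notMem_radicalSubmodule : x ∉ radicalSubmodule Λ U := fun hx =>
  h.smul_ne_zero (h.pathClass_smul_eq_zero hQ hπ hx)

theorem exists_sub_mem_radicalSubmodule (u : U) :
    ∃ c : K, u - c • x ∈ radicalSubmodule Λ U := by
  classical
  obtain ⟨c, rfl⟩ := h.exists_eq_sum u
  refine ⟨c a, ?_⟩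
  rw [← Finset.add_sum_erase _ _ (Finset.mem_univ a), initialPart_start hQ, h.vertexIdem_smul,
    add_sub_cancel_left]
  refine sum_mem fun i hi => ?_
  rw [smul_comm]
  exact smul_mem_radicalSubmodule
    (initialPart_mem_jacobson hQ hπ (Finset.ne_of_mem_erase hi)) _

theorem mul_pathClass_smul_eq_zero {r : Λ} (hr : r ∈ Ring.jacobson Λ) :
    (r * pathClass π p) • x = 0 := by
  rw [← sum_vertexIdem_smul π ((r * pathClass π p) • x)]
  refine Finset.sum_eq_zero fun k _ => ?_
  by_cases hk : k ∈ p.vertices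
  · obtain ⟨-, w, -⟩ := mem_vertices_iff_exists_comp.1 hk
    rw [← mul_smul, ← vertexIdem_mul_pathClass π p, ← mul_assoc, ← mul_assoc,
      vertexIdem_mul_mul_vertexIdem_eq_zero_of_mem_jacobson hQ hπ w hr, zero_mul, zero_smul]
  · exact h.vertexIdem_smul_of_notMem hQ hk _

theorem mul_vertexIdem_mem_jacobson {l : Λ} (hl : (l * pathClass π p) • x = 0) :
    l * vertexIdem π b ∈ Ring.jacobson Λ := by
  obtain ⟨c, hc⟩ := exists_vertexIdem_mul_mul_vertexIdem_eq_smul hQ hπ b l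
  have hc0 : c • pathClass π p • x = 0 := by
    calc c • pathClass π p • x
        = ((c • vertexIdem π b) * pathClass π p) • x := by
          rw [smul_mul_assoc, vertexIdem_mul_pathClass, smul_assoc]
      _ = vertexIdem π b • (l * pathClass π p) • x := by
          rw [← hc, mul_assoc, vertexIdem_mul_pathClass, mul_assoc, mul_smul]
      _ = 0 := by rw [hl, smul_zero]
  refine (mem_jacobson_iff_vertexIdem hQ hπ).2 fun i => ?_
  by_cases hi : i = b
  · rw [hi, ← mul_assoc, mul_assoc, vertexIdem_mul_self, hc,
      (smul_eq_zero.1 hc0).resolve_right h.smul_ne_zero, zero_smul]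
  · rw [← mul_assoc, mul_assoc, vertexIdem_mul_of_ne π (Ne.symm hi), mul_zero]

end IsMastGenerator

end Mast

section Conditions

variable {K : Type*} [Field K] {Q : Type*} [Quiver Q] [Fintype Q]
  {Λ : Type*} [Ring Λ] [Algebra K Λ]

theorem mem_leftTimes {L : Ideal Λ} {z l : Λ} : l ∈ leftTimes K L z ↔ ∃ r ∈ L, r * z = l :=
  Iff.rfl

theorem mem_timesLeft {L : Ideal Λ} {z l : Λ} : l ∈ timesLeft K z L ↔ ∃ r ∈ L, z * r = l :=
  Iff.rfl

/-- The elements that are sent into `W` by all elements of `R`. For `W = ⊥` in `Λ` itself, this is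
the right annihilator of `R`. -/
def smulPreimage (K : Type*) [Field K] {Λ : Type*} [Ring Λ] [Algebra K Λ] {V : Type*}
    [AddCommGroup V] [Module K V] [Module Λ V] [IsScalarTower K Λ V] (R : Set Λ)
    (W : Submodule Λ V) : Submodule K V where
  carrier := {z | ∀ r ∈ R, r • z ∈ W}
  add_mem' hy hz r hr := by rw [smul_add]; exact add_mem (hy r hr) (hz r hr)
  zero_mem' r _ := by rw [smul_zero]; exact zero_mem W
  smul_mem' c z hz r hr := by
    rw [smul_comm]; exact (W.restrictScalars K).smul_mem c (hz r hr)

theorem mem_smulPreimage_bot {R : Set Λ} {z : Λ} :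
    z ∈ smulPreimage K R (⊥ : Submodule Λ Λ) ↔ ∀ r ∈ R, r * z = 0 :=
  Iff.rfl

theorem mul_mem_smulPreimage_bot {R : Set Λ} {z : Λ}
    (hz : z ∈ smulPreimage K R (⊥ : Submodule Λ Λ)) (l : Λ) :
    z * l ∈ smulPreimage K R (⊥ : Submodule Λ Λ) := fun r hr => by
  rw [smul_eq_mul, ← mul_assoc, mem_smulPreimage_bot.1 hz r hr, zero_mul]
  exact zero_mem _

variable (π : PathAlgebra K Q →ₐ[K] Λ) {a b : Q} (p : Path a b)

/-- The annihilator of `x` is as small as a mast `p` permits: if `x` generates a module with mast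
`p`, this says that the module is `Λe / Jp`, where `e` is the vertex at which `p` starts. -/
def IsPresentedByMast {U : Type*} [AddCommGroup U] [Module Λ U] (x : U) : Prop :=
  ∀ l : Λ, l • x = 0 → l * vertexIdem π a ∈ leftTimes K (Ring.jacobson Λ) (pathClass π p)

/-- The dual of `IsPresentedByMast`, relative to `R`: with `e` the vertex at which `p` ends, every
element of `e Ann(U)` agrees with an element of `pJ` up to the right annihilator of `R`. -/
def IsCopresentedByMast (U : Type*) [AddCommGroup U] [Module Λ U] (R : Set Λ) : Prop :=
  timesLeft K (vertexIdem π b) (Module.annihilator Λ U) ≤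
    timesLeft K (pathClass π p) (Ring.jacobson Λ) ⊔ smulPreimage K R ⊥

/-- Clauses (i) and (ii) of `ConditionB`, for a given set `R`. -/
structure TerminalSubpathConditions (R : Set Λ) : Prop where
  exists_mem_timesLeft : ∀ (i j : Q) (γ : i ⟶ j) (u' : Path a j) (w' : Path j b),
    p = u'.comp w' → j ≠ a → i ∉ p.vertices →
      ∃ w ∈ timesLeft K (pathClass π p) (Ring.jacobson Λ),
        ∀ r ∈ R, r * pathClass π (γ.toPath.comp w') = r * w
  mem_span_singleton : ∀ (i j : Q) (δ : i ⟶ j) (u : Path a i) (w : Path i b) (u' : Path a j)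
    (w' : Path j b), p = u.comp w → p = u'.comp w' → ¬ IsArrowOf δ p →
      ∀ r ∈ R, r * pathClass π (δ.toPath.comp w') ∈ Submodule.span K {r * pathClass π w}

variable {π p}

theorem IsArrowOf.exists_eq_comp {Q : Type*} [Quiver Q] (hQ : QuiverIsAcyclic Q) {a b i j : Q}
    {p : Path a b} {δ : i ⟶ j} (hδ : IsArrowOf δ p) {u : Path a i} {w : Path i b}
    (h : p = u.comp w) : ∃ w' : Path j b, p = (u.cons δ).comp w' ∧ w = δ.toPath.comp w' := by
  obtain ⟨v, w', hv⟩ := hδ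
  have hv' : p = v.comp (δ.toPath.comp w') := by
    rw [hv, ← Path.comp_assoc, Path.comp_toPath_eq_cons]
  obtain ⟨rfl, rfl⟩ := hQ.comp_eq_comp (h.symm.trans hv')
  exact ⟨w', hv, rfl⟩

variable (hQ : QuiverIsAcyclic Q) (hπ : Function.Surjective π)
include hQ hπ

theorem ConditionA.pathClass_mul_initialPart_mem (hA : ConditionA π p) {i j : Q} (ε : i ⟶ j)
    (k : Q) : pathClass π ε.toPath * initialPart π p k ∈
      Submodule.span K (Set.range (initialPart π p)) ⊔
        leftTimes K (Ring.jacobson Λ) (pathClass π p) := by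
  obtain rfl | hik := eq_or_ne i k
  swap
  · rw [← pathClass_mul_vertexIdem π ε.toPath, ← vertexIdem_mul_initialPart hQ, mul_assoc,
      ← mul_assoc (vertexIdem π i), vertexIdem_mul_of_ne π hik, zero_mul, mul_zero]
    exact zero_mem _
  by_cases hi : i ∈ p.vertices
  swap
  · rw [initialPart_of_notMem hi, mul_zero]
    exact zero_mem _
  obtain ⟨u, w, huw⟩ := mem_vertices_iff_exists_comp.1 hi
  rw [initialPart_eq hQ huw, ← pathClass_cons]
  by_cases hj : j ∈ p.vertices
  · refine Submodule.mem_sup_left ?_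
    by_cases hε : IsArrowOf ε p
    · obtain ⟨w', hw', -⟩ := hε.exists_eq_comp hQ huw
      rw [← initialPart_eq hQ hw']
      exact Submodule.subset_span ⟨j, rfl⟩
    · obtain ⟨u', w', huw'⟩ := mem_vertices_iff_exists_comp.1 hj
      refine Submodule.span_mono ?_ (hA.2 i j ε u w u' w' huw huw' hε)
      rw [Set.singleton_subset_iff, ← initialPart_eq hQ huw']
      exact ⟨j, rfl⟩
  · refine Submodule.mem_sup_right ?_
    obtain rfl | hib := eq_or_ne i b
    · rw [pathClass_cons, ← initialPart_eq hQ huw, initialPart_end hQ]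
      exact mem_leftTimes.2 ⟨_, pathClass_mem_jacobson hQ hπ _ (hQ.ne_of_hom ε), rfl⟩
    · exact hA.1 i j ε u w huw hib hj

theorem ConditionA.mul_vertexIdem_mem_sup (hA : ConditionA π p) (l : Λ) :
    l * vertexIdem π a ∈ Submodule.span K (Set.range (initialPart π p)) ⊔
      leftTimes K (Ring.jacobson Λ) (pathClass π p) := by
  set G := Submodule.span K (Set.range (initialPart π p)) ⊔
    leftTimes K (Ring.jacobson Λ) (pathClass π p)
  refine mul_vertexIdem_mem hπ ?_ (fun i j ε => ?_) l
  · rw [← initialPart_start (p := p) hQ]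
    exact Submodule.mem_sup_left (Submodule.subset_span ⟨a, rfl⟩)
  · suffices hG : G ≤ G.comap (LinearMap.mulLeft K (pathClass π ε.toPath)) from
      fun _ hg => hG hg
    refine sup_le (Submodule.span_le.2 ?_) ?_
    · rintro _ ⟨k, rfl⟩
      exact hA.pathClass_mul_initialPart_mem hQ hπ ε k
    · rintro _ ⟨r, hr, rfl⟩
      exact Submodule.mem_sup_right
        (mem_leftTimes.2 ⟨_, (Ring.jacobson Λ).mul_mem_left _ hr, mul_assoc _ _ _⟩)

theorem IsPresentedByMast.vertexIdem_mul_mul_vertexIdem_eq_zero {M : Type*} [AddCommGroup M]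
    [Module Λ M] {x : M} (hx : IsPresentedByMast π p x) {l : Λ} (hl : l • x = 0) {j : Q}
    (w : Path j b) : vertexIdem π j * l * vertexIdem π a = 0 := by
  obtain ⟨r, hr, hrl⟩ := mem_leftTimes.1 (hx l hl)
  rw [mul_assoc, ← hrl, ← vertexIdem_mul_pathClass π p, ← mul_assoc, ← mul_assoc,
    vertexIdem_mul_mul_vertexIdem_eq_zero_of_mem_jacobson hQ hπ w hr, zero_mul]

variable {U : Type*} [AddCommGroup U] [Module K U] [Module Λ U] [IsScalarTower K Λ U] {x : U}

namespace IsMastGenerator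

variable (h : IsMastGenerator π p x)
include h

theorem isPresentedByMast_of_conditionA (hA : ConditionA π p) : IsPresentedByMast π p x := by
  intro l hl
  obtain ⟨y, hy, z, hz, hyz⟩ := Submodule.mem_sup.1 (hA.mul_vertexIdem_mem_sup hQ hπ l)
  obtain ⟨c, rfl⟩ := (Submodule.mem_span_range_iff_exists_fun K).1 hy
  obtain ⟨r, hr, rfl⟩ := mem_leftTimes.1 hz
  have hsum : ∑ i, c i • initialPart π p i • x = 0 := by
    calc ∑ i, c i • initialPart π p i • x
        = (∑ i, c i • initialPart π p i + r * pathClass π p) • x := by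
          rw [add_smul, h.mul_pathClass_smul_eq_zero hQ hπ hr, add_zero, Finset.sum_smul]
          simp only [smul_assoc]
      _ = 0 := by rw [hyz, mul_smul, h.vertexIdem_smul, hl]
  rw [← hyz, Finset.sum_eq_zero fun i _ =>
    h.smul_initialPart_eq_zero_of_terminalPart_smul hQ (by rw [hsum, smul_zero]), zero_add]
  exact hz

theorem conditionA_of_isPresentedByMast (hx : IsPresentedByMast π p x) : ConditionA π p := by
  constructor
  · intro i j β u _ _ _ hj
    have hβ : pathClass π (u.cons β) • x = 0 := by
      rw [← vertexIdem_mul_pathClass, mul_smul, h.vertexIdem_smul_of_notMem hQ hj]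
    simpa only [pathClass_mul_vertexIdem] using hx _ hβ
  · intro i j δ u _ u' w' _ huw' _
    obtain ⟨c, hc⟩ := h.vertexIdem_smul_eq hQ j (pathClass π (u.cons δ) • x)
    rw [← mul_smul, vertexIdem_mul_pathClass, initialPart_eq hQ huw'] at hc
    have hzero := hx.vertexIdem_mul_mul_vertexIdem_eq_zero hQ hπ
      (l := pathClass π (u.cons δ) - c • pathClass π u')
      (by rw [sub_smul, smul_assoc, hc, sub_self]) w'
    rw [mul_sub, mul_smul_comm, vertexIdem_mul_pathClass, vertexIdem_mul_pathClass, sub_mul,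
      smul_mul_assoc, pathClass_mul_vertexIdem, pathClass_mul_vertexIdem, sub_eq_zero] at hzero
    exact Submodule.mem_span_singleton.2 ⟨c, hzero.symm⟩

theorem isPresentedByMast_iff_conditionA : IsPresentedByMast π p x ↔ ConditionA π p :=
  ⟨h.conditionA_of_isPresentedByMast hQ hπ, h.isPresentedByMast_of_conditionA hQ hπ⟩

end IsMastGenerator

end Conditions

section TerminalConditions

variable {K : Type*} [Field K] {Q : Type*} [Quiver Q] [Fintype Q]
  {Λ : Type*} [Ring Λ] [Algebra K Λ] {π : PathAlgebra K Q →ₐ[K] Λ} {a b : Q} {p : Path a b}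

theorem conditionB_iff : ConditionB π p ↔ ∃ R : Set Λ, R ⊆ (Ring.jacobson Λ : Set Λ) ∧
    IsBasisModJSq K R (pathClass π p) ∧ TerminalSubpathConditions π p R :=
  ⟨fun ⟨R, hRJ, hbasis, hi, hii⟩ => ⟨R, hRJ, hbasis, hi, hii⟩,
    fun ⟨R, hRJ, hbasis, hi, hii⟩ => ⟨R, hRJ, hbasis, hi, hii⟩⟩

theorem sub_mem_smulPreimage_bot {R : Set Λ} {y z : Λ} :
    y - z ∈ smulPreimage K R (⊥ : Submodule Λ Λ) ↔ ∀ r ∈ R, r * y = r * z := by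
  simp only [mem_smulPreimage_bot, mul_sub, sub_eq_zero]

variable {R : Set Λ}

namespace TerminalSubpathConditions

variable (hT : TerminalSubpathConditions π p R) (hA : ConditionA π p)
  (hR : ∀ r ∈ R, r * pathClass π p ≠ 0)

include hT hA hR in
theorem exists_sub_mem {i j : Q} {δ : i ⟶ j} {u : Path a i} {w : Path i b} {u' : Path a j}
    {w' : Path j b} (hp : p = u.comp w) (hp' : p = u'.comp w') (hδ : ¬ IsArrowOf δ p) :
    ∃ c : K, pathClass π w' * pathClass π δ.toPath - c • pathClass π w ∈
      smulPreimage K R (⊥ : Submodule Λ Λ) := by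
  obtain ⟨c, hc⟩ := Submodule.mem_span_singleton.1 (hA.2 i j δ u w u' w' hp hp' hδ)
  refine ⟨c, sub_mem_smulPreimage_bot.2 fun r hr => ?_⟩
  obtain ⟨d, hd⟩ := Submodule.mem_span_singleton.1 (hT.2 i j δ u w u' w' hp hp' hδ r hr)
  -- Both scalars are read off from `r * p`, by cutting `p` at `i` and at `j`.
  have hdc : d • (r * pathClass π p) = c • (r * pathClass π p) := by
    calc d • (r * pathClass π p)
        = d • (r * pathClass π w) * pathClass π u := by
          rw [smul_mul_assoc, mul_assoc, pathClass_mul_pathClass, ← hp]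
      _ = r * (pathClass π w' * pathClass π (u.cons δ)) := by
          rw [hd, pathClass_cons, ← pathClass_mul_pathClass]
          simp only [mul_assoc]
      _ = c • (r * pathClass π p) := by
          rw [← hc, mul_smul_comm, mul_smul_comm, pathClass_mul_pathClass, ← hp']
  rw [pathClass_mul_pathClass, ← hd, smul_left_injective K (hR r hr) hdc, mul_smul_comm]

variable (hQ : QuiverIsAcyclic Q) (hπ : Function.Surjective π)
include hQ hπ hT hA hR

theorem terminalPart_mul_pathClass_mem {i j : Q} (ε : i ⟶ j) (k : Q) :
    terminalPart π p k * pathClass π ε.toPath ∈ Submodule.span K (Set.range (terminalPart π p)) ⊔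
      (timesLeft K (pathClass π p) (Ring.jacobson Λ) ⊔ smulPreimage K R ⊥) := by
  obtain rfl | hkj := eq_or_ne k j
  swap
  · rw [← terminalPart_mul_vertexIdem hQ, mul_assoc, vertexIdem_mul_pathClass_of_ne _ _ hkj,
      mul_zero]
    exact zero_mem _
  by_cases hk : k ∈ p.vertices
  swap
  · rw [terminalPart_of_notMem hk, zero_mul]
    exact zero_mem _
  obtain ⟨u', w', huw'⟩ := mem_vertices_iff_exists_comp.1 hk
  rw [terminalPart_eq hQ huw']
  by_cases hi : i ∈ p.vertices
  · obtain ⟨u, w, huw⟩ := mem_vertices_iff_exists_comp.1 hi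
    have hw : pathClass π w ∈ Submodule.span K (Set.range (terminalPart π p)) := by
      rw [← terminalPart_eq hQ huw]
      exact Submodule.subset_span ⟨i, rfl⟩
    by_cases hε : IsArrowOf ε p
    · obtain ⟨w₀, hw₀, rfl⟩ := hε.exists_eq_comp hQ huw
      obtain ⟨-, rfl⟩ := hQ.comp_eq_comp (huw'.symm.trans hw₀)
      rw [pathClass_mul_pathClass]
      exact Submodule.mem_sup_left hw
    · obtain ⟨c, hc⟩ := hT.exists_sub_mem hA hR huw huw' hε
      rw [← sub_add_cancel (_ * _) (c • pathClass π w), add_comm]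
      exact Submodule.add_mem_sup (Submodule.smul_mem _ _ hw) (Submodule.mem_sup_right hc)
  · refine Submodule.mem_sup_right ?_
    obtain rfl | hka := eq_or_ne k a
    · rw [← terminalPart_eq hQ huw', terminalPart_start hQ]
      exact Submodule.mem_sup_left
        (mem_timesLeft.2 ⟨_, pathClass_mem_jacobson hQ hπ _ (hQ.ne_of_hom ε), rfl⟩)
    · obtain ⟨w, hw, hrw⟩ := hT.exists_mem_timesLeft i k ε u' w' huw' hka hi
      rw [pathClass_mul_pathClass, ← add_sub_cancel w (pathClass π (ε.toPath.comp w'))]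
      exact Submodule.add_mem_sup hw (sub_mem_smulPreimage_bot.2 hrw)

theorem vertexIdem_mul_mem_sup (l : Λ) :
    vertexIdem π b * l ∈ Submodule.span K (Set.range (terminalPart π p)) ⊔
      (timesLeft K (pathClass π p) (Ring.jacobson Λ) ⊔ smulPreimage K R ⊥) := by
  set H := Submodule.span K (Set.range (terminalPart π p)) ⊔
    (timesLeft K (pathClass π p) (Ring.jacobson Λ) ⊔ smulPreimage K R ⊥)
  refine vertexIdem_mul_mem hπ ?_ (fun i j ε => ?_) l
  · rw [← terminalPart_end (p := p) hQ]
    exact Submodule.mem_sup_left (Submodule.subset_span ⟨b, rfl⟩)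
  · suffices hH : H ≤ H.comap (LinearMap.mulRight K (pathClass π ε.toPath)) from
      fun _ hg => hH hg
    refine sup_le (Submodule.span_le.2 ?_) (sup_le ?_ ?_)
    · rintro _ ⟨k, rfl⟩
      exact hT.terminalPart_mul_pathClass_mem hA hR hQ hπ ε k
    · rintro _ ⟨w, hw, rfl⟩
      exact Submodule.mem_sup_right (Submodule.mem_sup_left
        (mem_timesLeft.2 ⟨_, Ideal.mul_mem_right _ _ hw, (mul_assoc _ _ _).symm⟩))
    · exact fun n hn =>
        Submodule.mem_sup_right (Submodule.mem_sup_right (mul_mem_smulPreimage_bot hn _))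

end TerminalSubpathConditions

theorem sum_smul_terminalPart_mul_initialPart (hQ : QuiverIsAcyclic Q) (c : Q → K) {k : Q}
    (hk : k ∈ p.vertices) :
    (∑ i, c i • terminalPart π p i) * initialPart π p k = c k • pathClass π p := by
  rw [Finset.sum_mul, Finset.sum_eq_single k]
  · rw [smul_mul_assoc, terminalPart_mul_initialPart hQ hk]
  · intro i _ hik
    rw [smul_mul_assoc, terminalPart_mul_initialPart_of_ne hQ hik, smul_zero]
  · exact fun h => absurd (Finset.mem_univ k) h

variable {U : Type*} [AddCommGroup U] [Module K U] [Module Λ U] [IsScalarTower K Λ U] {x : U}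
  (h : IsMastGenerator π p x) (hQ : QuiverIsAcyclic Q) (hπ : Function.Surjective π)
include h hQ hπ

theorem TerminalSubpathConditions.isCopresentedByMast (hT : TerminalSubpathConditions π p R)
    (hx : IsPresentedByMast π p x) (hR : ∀ r ∈ R, r * pathClass π p ≠ 0) :
    IsCopresentedByMast π p U R := by
  rintro _ ⟨τ, hτ, rfl⟩
  have hA := h.conditionA_of_isPresentedByMast hQ hπ hx
  have hτu (k : Q) : vertexIdem π b * τ * initialPart π p k = 0 := by
    rw [← initialPart_mul_vertexIdem hQ, ← mul_assoc, mul_assoc (vertexIdem π b)]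
    refine hx.vertexIdem_mul_mul_vertexIdem_eq_zero hQ hπ ?_ Path.nil
    rw [mul_smul, Module.mem_annihilator.1 hτ]
  obtain ⟨y, hy, z, hz, hyz⟩ := Submodule.mem_sup.1 (hT.vertexIdem_mul_mem_sup hA hR hQ hπ τ)
  obtain ⟨c, rfl⟩ := (Submodule.mem_span_range_iff_exists_fun K).1 hy
  rw [LinearMap.mulLeft_apply, ← hyz]
  refine add_mem (sum_mem fun k _ => ?_) hz
  by_cases hk : k ∈ p.vertices
  swap
  · rw [terminalPart_of_notMem hk, smul_zero]
    exact zero_mem _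
  obtain ⟨_, ⟨w, hw, rfl⟩, n, hn, rfl⟩ := Submodule.mem_sup.1 hz
  have hcn : c k • pathClass π p + n * initialPart π p k = 0 := by
    rw [← hτu k, ← hyz, add_mul, sum_smul_terminalPart_mul_initialPart hQ c hk, add_mul,
      LinearMap.mulLeft_apply, pathClass_mul_mul_initialPart hQ hπ hw, zero_add]
  refine Submodule.mem_sup_right (mem_smulPreimage_bot.2 fun r hr => ?_)
  have hck : c k • (r * pathClass π p) = 0 := by
    rw [← mul_smul_comm, eq_neg_of_add_eq_zero_left hcn, mul_neg,
      mem_smulPreimage_bot.1 (mul_mem_smulPreimage_bot hn _) r hr, neg_zero]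
  rw [(smul_eq_zero.1 hck).resolve_right (hR r hr), zero_smul, mul_zero]

theorem IsCopresentedByMast.terminalSubpathConditions (hU : IsCopresentedByMast π p U R) :
    TerminalSubpathConditions π p R where
  exists_mem_timesLeft i j γ _ w' _ _ hi := by
    have hγ : pathClass π (γ.toPath.comp w') ∈ Module.annihilator Λ U :=
      Module.mem_annihilator.2 fun m => by
        rw [← pathClass_mul_vertexIdem, mul_smul, h.vertexIdem_smul_of_notMem hQ hi, smul_zero]
    obtain ⟨w, hw, n, hn, hwn⟩ := Submodule.mem_sup.1 (hU ⟨_, hγ, vertexIdem_mul_pathClass π _⟩)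
    refine ⟨w, hw, (sub_mem_smulPreimage_bot (K := K)).1 ?_⟩
    rwa [← hwn, add_sub_cancel_left]
  mem_span_singleton i j δ u w _ w' huw _ _ r hr := by
    obtain ⟨c, hc⟩ := h.vertexIdem_smul_eq hQ b
      (pathClass π (δ.toPath.comp w') • initialPart π p i • x)
    rw [← mul_smul, vertexIdem_mul_pathClass, initialPart_end hQ] at hc
    set τ := pathClass π (δ.toPath.comp w') - c • pathClass π w with hτ
    have hτi : τ * vertexIdem π i = τ := by
      rw [hτ, sub_mul, smul_mul_assoc, pathClass_mul_vertexIdem, pathClass_mul_vertexIdem]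
    have hbτ : vertexIdem π b * τ = τ := by
      rw [hτ, mul_sub, mul_smul_comm, vertexIdem_mul_pathClass, vertexIdem_mul_pathClass]
    have hτU : τ ∈ Module.annihilator Λ U := Module.mem_annihilator.2 fun m => by
      obtain ⟨d, hd⟩ := h.vertexIdem_smul_eq hQ i m
      rw [← hτi, mul_smul, hd, smul_comm, hτ, sub_smul, hc, smul_assoc, ← mul_smul,
        ← terminalPart_eq hQ huw, terminalPart_mul_initialPart hQ
          (mem_vertices_iff_exists_comp.2 ⟨u, w, huw⟩), sub_self, smul_zero]
    obtain ⟨_, ⟨v, hv, rfl⟩, n, hn, hvn⟩ := Submodule.mem_sup.1 (hU ⟨τ, hτU, hbτ⟩)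
    have hτn : τ ∈ smulPreimage K R (⊥ : Submodule Λ Λ) := by
      rw [← hτi, ← hvn, add_mul, LinearMap.mulLeft_apply, ← pathClass_mul_vertexIdem,
        mul_assoc (pathClass π p), mul_assoc (pathClass π p),
        vertexIdem_mul_mul_vertexIdem_eq_zero_of_mem_jacobson hQ hπ u hv, mul_zero, zero_add]
      exact mul_mem_smulPreimage_bot hn _
    rw [sub_mem_smulPreimage_bot.1 hτn r hr, mul_smul_comm]
    exact Submodule.smul_mem _ _ (Submodule.mem_span_singleton_self _)

theorem isCopresentedByMast_iff (hx : IsPresentedByMast π p x)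
    (hR : ∀ r ∈ R, r * pathClass π p ≠ 0) :
    IsCopresentedByMast π p U R ↔ TerminalSubpathConditions π p R :=
  ⟨IsCopresentedByMast.terminalSubpathConditions h hQ hπ,
    fun hT => hT.isCopresentedByMast h hQ hπ hx hR⟩

end TerminalConditions

section Basis

theorem le_of_le_sup_jacobson_smul {R M : Type*} [Ring R] [AddCommGroup M] [Module R M]
    {N L : Submodule R M} (hN : N.FG) (h : N ≤ L ⊔ Ring.jacobson R • N) : N ≤ L := by
  rw [← L.ker_mkQ, LinearMap.le_ker_iff_map]
  refine (hN.map _).eq_bot_of_le_jacobson_smul ?_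
  simpa only [Submodule.map_sup, Submodule.mkQ_map_self, bot_sup_eq, Submodule.map_smul''] using
    Submodule.map_mono (f := L.mkQ) h

variable {K : Type*} [Field K] {Λ : Type*} [Ring Λ] [Algebra K Λ] {R : Set Λ} {z : Λ}

namespace IsBasisModJSq

variable (hR : IsBasisModJSq K R z)
include hR

theorem mul_ne_zero {r : Λ} (hr : r ∈ R) : r * z ≠ 0 := fun h0 => by
  have hne := LinearIndependent.ne_zero ⟨_, r, hr, rfl⟩ hR.1
  simp only [id, h0, map_zero, ne_eq, not_true] at hne

theorem exists_sub_mem {r : Λ} (hr : r ∈ Ring.jacobson Λ) :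
    ∃ y ∈ Submodule.span K ((· * z) '' R), r * z - y ∈ leftTimes K (Ring.jacobson Λ ^ 2) z := by
  have hset : {y | ∃ r ∈ R, y = (leftTimes K (Ring.jacobson Λ ^ 2) z).mkQ (r * z)} =
      (leftTimes K (Ring.jacobson Λ ^ 2) z).mkQ '' ((· * z) '' R) := by
    ext y
    constructor
    · rintro ⟨r, hr, rfl⟩
      exact ⟨_, ⟨r, hr, rfl⟩, rfl⟩
    · rintro ⟨_, ⟨r, hr, rfl⟩, rfl⟩
      exact ⟨r, hr, rfl⟩
  obtain ⟨-, hspan⟩ := hR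
  rw [hset, Submodule.span_image] at hspan
  obtain ⟨y, hy, hyr⟩ := hspan.ge ⟨r * z, ⟨r, hr, rfl⟩, rfl⟩
  exact ⟨y, hy, (Submodule.Quotient.eq _).1 hyr.symm⟩

theorem mul_mem_span [IsNoetherianRing Λ] {r : Λ} (hr : r ∈ Ring.jacobson Λ) :
    r * z ∈ Submodule.span Λ ((· * z) '' R) := by
  refine le_of_le_sup_jacobson_smul
    (IsNoetherian.noetherian (Ring.jacobson Λ • Submodule.span Λ {z}))
    (Submodule.smul_le.2 fun s hs n hn => ?_)
    (Submodule.smul_mem_smul hr (Submodule.mem_span_singleton_self z))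
  obtain ⟨l, rfl⟩ := Submodule.mem_span_singleton.1 hn
  obtain ⟨y, hy, t, ht, hty⟩ := hR.exists_sub_mem (Ideal.mul_mem_right l _ hs)
  have hsum : y + t * z = s • l • z := by
    rw [smul_eq_mul, smul_eq_mul, ← mul_assoc, ← add_sub_cancel y (s * l * z), ← hty]
    rfl
  rw [SetLike.mem_coe, Submodule.restrictScalars_mem, Submodule.pow_succ, Submodule.pow_one] at ht
  rw [← hsum, ← Submodule.mul_smul]
  exact Submodule.add_mem_sup (Submodule.span_le_restrictScalars K Λ _ hy)
    (Submodule.smul_mem_smul ht (Submodule.mem_span_singleton_self z))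

end IsBasisModJSq

theorem exists_isBasisModJSq (hR : R ⊆ (Ring.jacobson Λ : Set Λ))
    (h : ∀ r ∈ Ring.jacobson Λ, ∃ l ∈ R, l * z = r * z) :
    ∃ R' ⊆ R, IsBasisModJSq K R' z := by
  set q := (leftTimes K (Ring.jacobson Λ ^ 2) z).mkQ
  obtain ⟨S, hS, hspan, hind⟩ := exists_linearIndependent K ((fun l => q (l * z)) '' R)
  have hset : {y | ∃ r ∈ {l ∈ R | q (l * z) ∈ S}, y = q (r * z)} = S := by
    ext y
    constructor
    · rintro ⟨r, hr, rfl⟩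
      exact hr.2
    · intro hy
      obtain ⟨l, hl, rfl⟩ := hS hy
      exact ⟨l, ⟨hl, hy⟩, rfl⟩
  refine ⟨{l ∈ R | q (l * z) ∈ S}, fun l hl => hl.1, ?_, ?_⟩
  · rw [hset]
    exact hind
  · rw [hset, hspan]
    refine le_antisymm (Submodule.span_le.2 ?_) ?_
    · rintro _ ⟨l, hl, rfl⟩
      exact ⟨l * z, mem_leftTimes.2 ⟨l, hR hl, rfl⟩, rfl⟩
    · rintro _ ⟨_, ⟨r, hr, rfl⟩, rfl⟩
      obtain ⟨l, hl, hlr⟩ := h r hr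
      rw [LinearMap.mulRight_apply, ← hlr]
      exact Submodule.subset_span ⟨l, hl, rfl⟩

end Basis

section Lifting

theorem exists_comp_eq_of_ker_le {R M N P : Type*} [Ring R] [AddCommGroup M] [Module R M]
    [AddCommGroup N] [Module R N] [AddCommGroup P] [Module R P] {q : M →ₗ[R] N}
    (hq : Function.Surjective q) {f : M →ₗ[R] P} (h : LinearMap.ker q ≤ LinearMap.ker f) :
    ∃ t : N →ₗ[R] P, t ∘ₗ q = f := by
  refine ⟨(LinearMap.ker q).liftQ f h ∘ₗ (q.quotKerEquivOfSurjective hq).symm, ?_⟩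
  ext m
  have hm : (q.quotKerEquivOfSurjective hq).symm (q m) = (LinearMap.ker q).mkQ m :=
    (LinearEquiv.symm_apply_eq _).2 rfl
  rw [LinearMap.comp_apply, LinearMap.comp_apply, LinearEquiv.coe_coe, hm]
  rfl

theorem exists_linearMap_apply_eq_of_smul_eq_zero {R M N : Type*} [Ring R] [AddCommGroup M]
    [Module R M] [AddCommGroup N] [Module R N] {x : M} (hx : ∀ m, ∃ r : R, r • x = m) {y : N}
    (h : ∀ r : R, r • x = 0 → r • y = 0) : ∃ s : M →ₗ[R] N, s x = y := by
  obtain ⟨s, hs⟩ := exists_comp_eq_of_ker_le (q := LinearMap.toSpanSingleton R M x) hx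
    (f := LinearMap.toSpanSingleton R N y) h
  exact ⟨s, by simpa only [LinearMap.comp_apply, LinearMap.toSpanSingleton_apply, one_smul] using
    LinearMap.congr_fun hs 1⟩

namespace IsIrreducibleMap

theorem isSplitMonomorphism_or_isSplitEpimorphism.{u, v, w, z} {R : Type u} [Ring R] {M : Type v}
    [AddCommGroup M] [Module R M] {N : Type w} [AddCommGroup N] [Module R N] {f : M →ₗ[R] N}
    (hf : IsIrreducibleMap f) {V : Type z} [AddCommGroup V] [Module R V] [Module.Finite R V]
    {φ : M →ₗ[R] V} {ψ : V →ₗ[R] N} (h : ψ ∘ₗ φ = f) :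
    IsSplitMonomorphism φ ∨ IsSplitEpimorphism ψ := by
  have : Small.{u} V := Module.Finite.small.{u} R V
  let e : Shrink.{u} V ≃ₗ[R] V := Shrink.linearEquiv R V
  have hcomp : (ψ ∘ₗ e.toLinearMap) ∘ₗ e.symm.toLinearMap ∘ₗ φ = f := by
    ext m
    simp only [LinearMap.comp_apply, LinearEquiv.coe_coe, LinearEquiv.apply_symm_apply, ← h]
  rcases hf.2.2 (Shrink.{u} V) _ _ hcomp with ⟨g, hg⟩ | ⟨g, hg⟩
  · exact Or.inl ⟨g ∘ₗ e.symm.toLinearMap, hg⟩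
  · exact Or.inr ⟨e.toLinearMap ∘ₗ g, hg⟩

variable {R : Type*} [Ring R] [IsNoetherianRing R] {U : Type*} [AddCommGroup U] [Module R U]
  [Module.Finite R U] {N : Submodule R U}

/- The embedding factors through the pullback of `f` and `U → U ⧸ N`. -/
theorem exists_lift_or_exists_factor (hN : IsIrreducibleMap N.subtype) {V : Type*}
    [AddCommGroup V] [Module R V] [Module.Finite R V] (f : V →ₗ[R] U ⧸ N) :
    (∃ t : V →ₗ[R] U, N.mkQ ∘ₗ t = f) ∨ ∃ s : U →ₗ[R] V, f ∘ₗ s = N.mkQ := by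
  let E : Submodule R (U × V) :=
    LinearMap.eqLocus (N.mkQ ∘ₗ LinearMap.fst R U V) (f ∘ₗ LinearMap.snd R U V)
  have hE (z : E) : N.mkQ z.1.1 = f z.1.2 := z.2
  let φ : N →ₗ[R] E := LinearMap.codRestrict E (LinearMap.inl R U V ∘ₗ N.subtype) fun n => by
    simp [E, LinearMap.mem_eqLocus]
  rcases hN.isSplitMonomorphism_or_isSplitEpimorphism (φ := φ)
    (ψ := LinearMap.fst R U V ∘ₗ E.subtype) rfl with ⟨g, hg⟩ | ⟨s, hs⟩
  · left
    have hsurj : Function.Surjective (LinearMap.snd R U V ∘ₗ E.subtype) := fun y => by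
      obtain ⟨u, hu⟩ := N.mkQ_surjective (f y)
      exact ⟨⟨(u, y), hu⟩, rfl⟩
    obtain ⟨t, ht⟩ := exists_comp_eq_of_ker_le hsurj
      (f := LinearMap.fst R U V ∘ₗ E.subtype - N.subtype ∘ₗ g) fun z (hz : z.1.2 = 0) => by
        have hz1 : z.1.1 ∈ N := by
          rw [← Submodule.Quotient.mk_eq_zero, ← Submodule.mkQ_apply, hE, hz, map_zero]
        have hzφ : φ ⟨z.1.1, hz1⟩ = z := Subtype.ext (Prod.ext rfl hz.symm)
        have hgz : g z = ⟨z.1.1, hz1⟩ :=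
          (congrArg g hzφ).symm.trans (LinearMap.congr_fun hg _)
        exact sub_eq_zero.2 (congrArg Subtype.val hgz).symm
    refine ⟨t, LinearMap.ext fun y => ?_⟩
    obtain ⟨z, rfl⟩ := hsurj y
    calc N.mkQ (t z.1.2) = N.mkQ (z.1.1 - g z) := congrArg _ (LinearMap.congr_fun ht z)
      _ = f z.1.2 := by
        rw [map_sub, Submodule.mkQ_apply _ (g z : U), (Submodule.Quotient.mk_eq_zero N).2 (g z).2,
          sub_zero, hE]
  · right
    refine ⟨LinearMap.snd R U V ∘ₗ E.subtype ∘ₗ s, LinearMap.ext fun u => ?_⟩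
    exact (hE (s u)).symm.trans (congrArg N.mkQ (LinearMap.congr_fun hs u))

end IsIrreducibleMap

end Lifting

section Necessity

variable {K : Type*} [Field K] {Q : Type*} [Quiver Q] [Fintype Q]
  {Λ : Type*} [Ring Λ] [Algebra K Λ] {π : PathAlgebra K Q →ₐ[K] Λ} {a b : Q} {p : Path a b}
  {U : Type*} [AddCommGroup U] [Module Λ U] {x : U}
  (hQ : QuiverIsAcyclic Q) (hπ : Function.Surjective π)
include hQ hπ

theorem vertexIdem_mul_mul_one_sub_mem_jacobson (i : Q) (l : Λ) :
    vertexIdem π i * l * (1 - vertexIdem π i) ∈ Ring.jacobson Λ := by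
  refine (mem_jacobson_iff_vertexIdem hQ hπ).2 fun j => ?_
  obtain rfl | hij := eq_or_ne i j
  · rw [mul_assoc, mul_assoc, sub_mul, one_mul, vertexIdem_mul_self, sub_self, mul_zero, mul_zero]
  · rw [← mul_assoc, ← mul_assoc, vertexIdem_mul_of_ne π hij.symm, zero_mul, zero_mul, zero_mul]

theorem IsPresentedByMast.mem_timesLeft_sup_smulPreimage_bot (hx : IsPresentedByMast π p x)
    {R : Set Λ} {τ f : Λ} (hτ : τ ∈ Module.annihilator Λ U)
    (hbτ : vertexIdem π b * τ = τ)
    (hR : τ - pathClass π p * f ∈ smulPreimage K R (⊥ : Submodule Λ Λ)) :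
    τ ∈ timesLeft K (pathClass π p) (Ring.jacobson Λ) ⊔ smulPreimage K R ⊥ := by
  have hτa : τ * vertexIdem π a = 0 := by
    rw [← hbτ]
    exact hx.vertexIdem_mul_mul_vertexIdem_eq_zero hQ hπ (Module.mem_annihilator.1 hτ x) .nil
  refine Submodule.mem_sup.2 ⟨_, mem_timesLeft.2
    ⟨_, vertexIdem_mul_mul_one_sub_mem_jacobson hQ hπ a f, rfl⟩, _,
    mul_mem_smulPreimage_bot hR (1 - vertexIdem π a), ?_⟩
  calc pathClass π p * (vertexIdem π a * f * (1 - vertexIdem π a)) +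
        (τ - pathClass π p * f) * (1 - vertexIdem π a)
      = τ * (1 - vertexIdem π a) := by
        rw [← mul_assoc, ← mul_assoc, pathClass_mul_vertexIdem, ← add_mul, add_sub_cancel]
    _ = τ := by rw [mul_sub, mul_one, hτa, sub_zero]

namespace IsMastGenerator

variable [Module K U] [IsScalarTower K Λ U] (h : IsMastGenerator π p x)
include h

theorem vertexIdem_mul_mul_vertexIdem_eq_self {q : Λ} (hq : q • x - x ∈ radicalSubmodule Λ U) :
    vertexIdem π a * q * vertexIdem π a = vertexIdem π a := by
  obtain ⟨c, hc⟩ := exists_vertexIdem_mul_mul_vertexIdem_eq_smul hQ hπ a q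
  have hx : x ≠ 0 := fun hx => h.smul_ne_zero (by rw [hx, smul_zero])
  have hcx : (c - 1) • x = 0 := by
    calc (c - 1) • x = (vertexIdem π a * q * vertexIdem π a) • x - vertexIdem π a • x := by
          rw [hc, smul_assoc, h.vertexIdem_smul, sub_smul, one_smul]
      _ = vertexIdem π a • (q • x - x) := by
          rw [mul_smul, mul_smul, smul_sub, h.vertexIdem_smul]
      _ = 0 := h.vertexIdem_smul_eq_zero hQ hπ hq
  rw [hc, sub_eq_zero.1 ((smul_eq_zero.1 hcx).resolve_right hx), one_smul]

variable [IsNoetherianRing Λ] (hab : a ≠ b)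
  (hirr : IsIrreducibleMap (radicalSubmodule Λ U).subtype)
include hab hirr

theorem exists_linearMap_quotient_span_of_isIrreducibleMap {ι : Type*} [Finite ι] {τ : ι → Λ}
    (hτ : ∀ i, τ i ∈ Module.annihilator Λ U) :
    ∃ s : U →ₗ[Λ] (Λ × (ι → Λ)) ⧸ Submodule.span Λ {(pathClass π p, τ)},
      ∃ y, Submodule.Quotient.mk y = s x ∧ y.1 • x - x ∈ radicalSubmodule Λ U := by
  classical
  have := Fintype.ofFinite ι
  have : Module.Finite Λ U := .of_surjective (LinearMap.toSpanSingleton Λ U x) h.exists_smul_eq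
  set N := radicalSubmodule Λ U
  set L := Submodule.span Λ {(pathClass π p, τ)}
  let f : (Λ × (ι → Λ)) ⧸ L →ₗ[Λ] U ⧸ N :=
    L.liftQ (N.mkQ ∘ₗ LinearMap.toSpanSingleton Λ U x ∘ₗ LinearMap.fst Λ Λ (ι → Λ)) <|
      (Submodule.span_singleton_le_iff_mem _ _).2 <| (Submodule.Quotient.mk_eq_zero N).2 <|
        smul_mem_radicalSubmodule (pathClass_mem_jacobson hQ hπ p hab) x
  rcases hirr.exists_lift_or_exists_factor f with ⟨t, ht⟩ | ⟨s, hs⟩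
  · exfalso
    have hN : t (L.mkQ (1, 0)) - x ∈ N := by
      refine (Submodule.Quotient.eq N).1 ((LinearMap.congr_fun ht (L.mkQ (1, 0))).trans ?_)
      exact congrArg N.mkQ (one_smul Λ x)
    have hp : pathClass π p • t (L.mkQ (1, 0)) = 0 := by
      have hsum : t (L.mkQ (0, τ)) = 0 :=
        ((t ∘ₗ L.mkQ ∘ₗ LinearMap.inr Λ Λ (ι → Λ)).pi_apply_eq_sum_univ τ).trans
          (Finset.sum_eq_zero fun i _ => Module.mem_annihilator.1 (hτ i) _)
      rw [← add_zero (_ • _), ← hsum, ← map_smul, ← map_smul, ← map_add, ← map_add,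
        Prod.smul_mk, Prod.mk_add_mk, smul_eq_mul, mul_one, smul_zero, add_zero, zero_add,
        Submodule.mkQ_apply, (Submodule.Quotient.mk_eq_zero L).2
          (Submodule.mem_span_singleton_self _), map_zero, hsum]
    have hpx := h.pathClass_smul_eq_zero hQ hπ hN
    rw [smul_sub, hp, zero_sub, neg_eq_zero] at hpx
    exact h.smul_ne_zero hpx
  · obtain ⟨y, hy⟩ := L.mkQ_surjective (s x)
    refine ⟨s, y, hy, (Submodule.Quotient.eq N).1 ?_⟩
    have := LinearMap.congr_fun hs x
    rw [LinearMap.comp_apply, ← hy] at this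
    exact this

theorem exists_factorization_of_isIrreducibleMap {ι : Type*} [Finite ι] {τ : ι → Λ}
    (hτ : ∀ i, τ i ∈ Module.annihilator Λ U) (hbτ : ∀ i, vertexIdem π b * τ i = τ i) :
    ∃ f : ι → Λ, ∀ l : Λ, l • x = 0 → ∃ r ∈ Ring.jacobson Λ,
      r * pathClass π p = l * vertexIdem π a ∧ ∀ i, r * τ i = l * vertexIdem π a * f i := by
  obtain ⟨s, ⟨q, f⟩, hs, hq⟩ :=
    h.exists_linearMap_quotient_span_of_isIrreducibleMap hQ hπ hab hirr hτ
  refine ⟨f, fun l hl => ?_⟩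
  have hmem : (l * vertexIdem π a) • (q, f) ∈ Submodule.span Λ {(pathClass π p, τ)} := by
    rw [← Submodule.Quotient.mk_eq_zero, Submodule.Quotient.mk_smul, hs, ← map_smul, mul_smul,
      h.vertexIdem_smul, hl, map_zero]
  obtain ⟨r, hr⟩ := Submodule.mem_span_singleton.1 hmem
  have hrp : r * pathClass π p = l * vertexIdem π a := by
    calc r * pathClass π p = r * pathClass π p * vertexIdem π a := by
          rw [mul_assoc, pathClass_mul_vertexIdem]
      _ = l * vertexIdem π a * q * vertexIdem π a :=
          congrArg (· * vertexIdem π a) (congrArg Prod.fst hr)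
      _ = l * vertexIdem π a := by
          rw [mul_assoc, mul_assoc, ← mul_assoc _ q,
            h.vertexIdem_mul_mul_vertexIdem_eq_self hQ hπ hq]
  refine ⟨r * vertexIdem π b, h.mul_vertexIdem_mem_jacobson hQ hπ ?_, ?_, fun i => ?_⟩
  · rw [hrp, mul_smul, h.vertexIdem_smul, hl]
  · rw [mul_assoc, vertexIdem_mul_pathClass, hrp]
  · rw [mul_assoc, hbτ]
    exact congrFun (congrArg Prod.snd hr) i

theorem isPresentedByMast_of_isIrreducibleMap : IsPresentedByMast π p x := by
  obtain ⟨_, hf⟩ := h.exists_factorization_of_isIrreducibleMap (ι := Empty) (τ := Empty.elim)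
    hQ hπ hab hirr (fun i => i.elim) fun i => i.elim
  intro l hl
  obtain ⟨r, hr, hrl, -⟩ := hf l hl
  exact mem_leftTimes.2 ⟨r, hr, hrl⟩

theorem exists_isCopresentedByMast_of_isIrreducibleMap [Module.Finite K Λ] :
    ∃ R : Set Λ, R ⊆ (Ring.jacobson Λ : Set Λ) ∧ IsBasisModJSq K R (pathClass π p) ∧
      IsCopresentedByMast π p U R := by
  obtain ⟨T, hT⟩ : (timesLeft K (vertexIdem π b) (Module.annihilator Λ U)).FG :=
    IsNoetherian.noetherian _
  have hTmem (τ : T) : τ.1 ∈ Module.annihilator Λ U ∧ vertexIdem π b * τ = τ := by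
    obtain ⟨l, hl, hlτ⟩ := mem_timesLeft.1 (hT ▸ Submodule.subset_span τ.2)
    rw [← hlτ, ← mul_assoc, vertexIdem_mul_self]
    exact ⟨Ideal.mul_mem_left _ _ hl, rfl⟩
  obtain ⟨f, hf⟩ := h.exists_factorization_of_isIrreducibleMap hQ hπ hab hirr
    (fun τ => (hTmem τ).1) fun τ => (hTmem τ).2
  obtain ⟨R, hR, hbasis⟩ := exists_isBasisModJSq (K := K) (z := pathClass π p)
    (R := {r | r ∈ Ring.jacobson Λ ∧ ∀ τ, r * (τ.1 - pathClass π p * f τ) = 0})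
    (fun r hr => hr.1) fun s hs => by
      obtain ⟨r, hr, hrs, hrτ⟩ := hf _ (h.mul_pathClass_smul_eq_zero hQ hπ hs)
      rw [mul_assoc, pathClass_mul_vertexIdem] at hrs
      refine ⟨r, ⟨hr, fun τ => ?_⟩, hrs⟩
      rw [mul_sub, hrτ, mul_assoc s, pathClass_mul_vertexIdem, ← hrs, mul_assoc, sub_self]
  refine ⟨R, fun r hr => (hR hr).1, hbasis, ?_⟩
  rw [IsCopresentedByMast, ← hT, Submodule.span_le]
  intro τ hτ
  have hx := h.isPresentedByMast_of_isIrreducibleMap hQ hπ hab hirr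
  exact hx.mem_timesLeft_sup_smulPreimage_bot hQ hπ
    (hTmem ⟨τ, hτ⟩).1 (hTmem ⟨τ, hτ⟩).2
    (mem_smulPreimage_bot.2 fun r hr => (hR hr).2 ⟨τ, hτ⟩)

end IsMastGenerator

end Necessity

section Sufficiency

variable {K : Type*} [Field K] {Q : Type*} [Quiver Q] [Fintype Q]
  {Λ : Type*} [Ring Λ] [Algebra K Λ] {π : PathAlgebra K Q →ₐ[K] Λ} {a b : Q} {p : Path a b}
  {U : Type*} [AddCommGroup U] [Module Λ U] {x : U}

section CorrectionSubspace

variable {V : Type*} [AddCommGroup V] [Module K V] [Module Λ V] [IsScalarTower K Λ V]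

variable (π p) in
/-- For a factorization `ψ ∘ φ` of `JU ↪ U` and `ψ y = x`, where `x` generates `U`: if `p y` lies in
this subspace, then `y` can be changed, without changing `ψ y`, so that `Rp` kills it. -/
noncomputable def correctionSubspace (R : Set Λ) (φ : radicalSubmodule Λ U →ₗ[Λ] V)
    (ψ : V →ₗ[Λ] U) : Submodule K V :=
  (((radicalSubmodule Λ U).comap ψ).restrictScalars K).map (Algebra.lsmul K K V (pathClass π p)) ⊔
    smulPreimage K R (LinearMap.range φ)

variable {R : Set Λ} {φ : radicalSubmodule Λ U →ₗ[Λ] V} {ψ : V →ₗ[Λ] U}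

theorem mem_correctionSubspace {z : V} : z ∈ correctionSubspace π p R φ ψ ↔
    ∃ k, ψ k ∈ radicalSubmodule Λ U ∧
      ∀ r ∈ R, r • (z - pathClass π p • k) ∈ LinearMap.range φ := by
  rw [correctionSubspace, Submodule.mem_sup]
  constructor
  · rintro ⟨_, ⟨k, hk, rfl⟩, n, hn, rfl⟩
    refine ⟨k, hk, fun r hr => ?_⟩
    rw [Algebra.lsmul_coe, add_sub_cancel_left]
    exact hn r hr
  · rintro ⟨k, hk, hkR⟩
    exact ⟨_, ⟨k, hk, rfl⟩, z - pathClass π p • k, hkR, add_sub_cancel _ _⟩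

theorem pathClass_smul_mem_correctionSubspace {y : V} (hy : ψ y ∈ radicalSubmodule Λ U) :
    pathClass π p • y ∈ correctionSubspace π p R φ ψ :=
  Submodule.mem_sup_left ⟨y, hy, rfl⟩

theorem map_mem_correctionSubspace (z : radicalSubmodule Λ U) :
    φ z ∈ correctionSubspace π p R φ ψ :=
  Submodule.mem_sup_right fun _ _ => Submodule.smul_mem _ _ ⟨z, rfl⟩

theorem IsCopresentedByMast.smul_mem_correctionSubspace (hR : IsCopresentedByMast π p U R) {τ : Λ}
    (hτ : τ ∈ timesLeft K (vertexIdem π b) (Module.annihilator Λ U)) (y : V) :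
    τ • y ∈ correctionSubspace π p R φ ψ := by
  obtain ⟨_, ⟨w, hw, rfl⟩, n, hn, rfl⟩ := Submodule.mem_sup.1 (hR hτ)
  rw [add_smul, LinearMap.mulLeft_apply, mul_smul]
  refine add_mem (pathClass_smul_mem_correctionSubspace ?_)
    (Submodule.mem_sup_right fun r hr => ?_)
  · rw [map_smul]
    exact smul_mem_radicalSubmodule hw _
  · rw [← mul_smul, mem_smulPreimage_bot.1 hn r hr, zero_smul]
    exact zero_mem _

end CorrectionSubspace

namespace IsMastGenerator

variable [Module K U] [IsScalarTower K Λ U] (h : IsMastGenerator π p x)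
include h

theorem isSplitEpimorphism_of_apply_eq (hx : IsPresentedByMast π p x) {V : Type*}
    [AddCommGroup V] [Module Λ V] {ψ : V →ₗ[Λ] U} {y : V} (hy : ψ y = x)
    (hJp : ∀ r ∈ Ring.jacobson Λ, (r * pathClass π p) • y = 0) : IsSplitEpimorphism ψ := by
  have hkill (l : Λ) (hl : l • x = 0) : l • vertexIdem π a • y = 0 := by
    obtain ⟨r, hr, hrl⟩ := mem_leftTimes.1 (hx l hl)
    rw [← mul_smul, ← hrl, hJp r hr]
  obtain ⟨s, hs⟩ := exists_linearMap_apply_eq_of_smul_eq_zero h.exists_smul_eq hkill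
  refine ⟨s, LinearMap.ext fun u => ?_⟩
  obtain ⟨l, rfl⟩ := h.exists_smul_eq u
  rw [LinearMap.comp_apply, map_smul, hs, map_smul, map_smul, hy, h.vertexIdem_smul,
    LinearMap.id_apply]

variable (hQ : QuiverIsAcyclic Q)
include hQ

theorem exists_sub_sum_smul_terminalPart_mem (l : Λ) : ∃ c : Q → K,
    (∀ i, (vertexIdem π b * l) • initialPart π p i • x = c i • pathClass π p • x) ∧
      vertexIdem π b * l - ∑ i, c i • terminalPart π p i ∈
        timesLeft K (vertexIdem π b) (Module.annihilator Λ U) := by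
  have hex (i : Q) : ∃ c : K,
      (vertexIdem π b * l) • initialPart π p i • x = c • pathClass π p • x := by
    obtain ⟨c, hc⟩ := h.vertexIdem_smul_eq hQ b (l • initialPart π p i • x)
    exact ⟨c, by rw [mul_smul, hc, initialPart_end hQ]⟩
  choose c hc using hex
  refine ⟨c, hc, mem_timesLeft.2 ⟨vertexIdem π b * l - ∑ i, c i • terminalPart π p i,
    Module.mem_annihilator.2 fun u => ?_, ?_⟩⟩
  · obtain ⟨d, rfl⟩ := h.exists_eq_sum u
    rw [Finset.smul_sum]
    refine Finset.sum_eq_zero fun k _ => ?_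
    by_cases hk : k ∈ p.vertices
    · rw [smul_comm, sub_smul, hc, ← mul_smul (∑ i, _),
        sum_smul_terminalPart_mul_initialPart hQ c hk, smul_assoc, sub_self, smul_zero]
    · rw [initialPart_of_notMem hk, zero_smul, smul_zero, smul_zero]
  · rw [mul_sub, ← mul_assoc, vertexIdem_mul_self, Finset.mul_sum]
    simp only [mul_smul_comm, vertexIdem_mul_terminalPart hQ]

theorem exists_linearMap_of_functional {V : Type*} [AddCommGroup V] [Module K V] [Module Λ V]
    [IsScalarTower K Λ V] (f : V →ₗ[K] K)
    (hf : ∀ τ ∈ timesLeft K (vertexIdem π b) (Module.annihilator Λ U), ∀ y : V, f (τ • y) = 0) :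
    ∃ g : V →ₗ[Λ] U, ∀ (l : Λ) (y : V),
      (vertexIdem π b * l) • g y = f ((vertexIdem π b * l) • y) • pathClass π p • x := by
  let g (y : V) : U := ∑ i, f (terminalPart π p i • y) • initialPart π p i • x
  have hg (l : Λ) (y : V) :
      (vertexIdem π b * l) • g y = f ((vertexIdem π b * l) • y) • pathClass π p • x := by
    obtain ⟨c, hc, hcl⟩ := h.exists_sub_sum_smul_terminalPart_mem hQ l
    have hfl := hf _ hcl y
    rw [sub_smul, map_sub, sub_eq_zero, Finset.sum_smul, map_sum] at hfl
    rw [hfl, Finset.smul_sum, Finset.sum_smul]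
    refine Finset.sum_congr rfl fun i _ => ?_
    rw [smul_comm, hc, smul_assoc, map_smul f, smul_smul, smul_eq_mul, mul_comm]
  have hinj {u v : U} (huv : ∀ l : Λ, (vertexIdem π b * l) • u = (vertexIdem π b * l) • v) :
      u = v := by
    refine sub_eq_zero.1 (h.eq_zero_of_terminalPart_smul hQ fun i => ?_)
    rw [← vertexIdem_mul_terminalPart hQ, smul_sub, huv, sub_self]
  refine ⟨⟨⟨g, fun y z => hinj fun l => ?_⟩, fun m y => hinj fun l => ?_⟩, hg⟩
  · rw [smul_add, hg, hg, hg, smul_add, map_add, add_smul]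
  · rw [RingHom.id_apply, ← mul_smul, mul_assoc]
    exact (hg l (m • y)).trans (by rw [← mul_smul, mul_assoc, hg])

variable (hπ : Function.Surjective π)
include hπ

theorem mem_radicalSubmodule_iff {u : U} :
    u ∈ radicalSubmodule Λ U ↔ pathClass π p • u = 0 := by
  refine ⟨h.pathClass_smul_eq_zero hQ hπ, fun hu => ?_⟩
  obtain ⟨c, hc⟩ := h.exists_sub_mem_radicalSubmodule hQ hπ u
  have hcx := h.pathClass_smul_eq_zero hQ hπ hc
  rw [smul_sub, hu, zero_sub, neg_eq_zero, smul_comm, smul_eq_zero_iff_left h.smul_ne_zero] at hcx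
  rwa [hcx, zero_smul, sub_zero] at hc

theorem mem_of_radicalSubmodule_lt {W : Submodule Λ U} (hW : radicalSubmodule Λ U < W) :
    x ∈ W := by
  obtain ⟨hle, u, huW, hu⟩ := SetLike.lt_iff_le_and_exists.1 hW
  obtain ⟨c, hc⟩ := h.exists_sub_mem_radicalSubmodule hQ hπ u
  have hc0 : c ≠ 0 := by
    rintro rfl
    exact hu (by simpa only [zero_smul, sub_zero] using hc)
  have hcx : c • x ∈ W := by
    rw [← sub_sub_self u (c • x)]
    exact sub_mem huW (hle hc)
  exact ((W.restrictScalars K).smul_mem_iff hc0).1 hcx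

variable {V : Type*} [AddCommGroup V] [Module K V] [Module Λ V] [IsScalarTower K Λ V]
  {φ : radicalSubmodule Λ U →ₗ[Λ] V} {ψ : V →ₗ[Λ] U}

theorem isSplitEpimorphism_of_mem_correctionSubspace (hx : IsPresentedByMast π p x) {R : Set Λ}
    (hR : ∀ r ∈ Ring.jacobson Λ, r * pathClass π p ∈ Submodule.span Λ ((· * pathClass π p) '' R))
    (hφψ : ψ ∘ₗ φ = (radicalSubmodule Λ U).subtype) {y : V} (hy : ψ y = x)
    (hmem : pathClass π p • y ∈ correctionSubspace π p R φ ψ) : IsSplitEpimorphism ψ := by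
  obtain ⟨k, hk, hkR⟩ := mem_correctionSubspace.1 hmem
  have hψφ (z : radicalSubmodule Λ U) : ψ (φ z) = z := LinearMap.congr_fun hφψ z
  have hrange (r : Λ) (hr : r ∈ Ring.jacobson Λ) :
      (r * pathClass π p) • (y - k) ∈ LinearMap.range φ := by
    suffices hle : Submodule.span Λ ((· * pathClass π p) '' R) ≤
        (LinearMap.range φ).comap (LinearMap.toSpanSingleton Λ V (y - k)) from hle (hR r hr)
    rw [Submodule.span_le]
    rintro _ ⟨l, hl, rfl⟩
    rw [SetLike.mem_coe, Submodule.mem_comap, LinearMap.toSpanSingleton_apply, mul_smul, smul_sub]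
    exact hkR l hl
  have hψy : ψ (y - k + φ ⟨ψ k, hk⟩) = x := by
    rw [map_add, map_sub, hψφ, sub_add_cancel, hy]
  refine h.isSplitEpimorphism_of_apply_eq hx hψy fun r hr => ?_
  obtain ⟨z, hz⟩ := add_mem (hrange r hr)
    (Submodule.smul_mem (LinearMap.range φ) (r * pathClass π p) ⟨⟨ψ k, hk⟩, rfl⟩)
  rw [← smul_add] at hz
  have hz0 : z = 0 := Subtype.ext <| by
    rw [← hψφ, hz, map_smul, hψy, h.mul_pathClass_smul_eq_zero hQ hπ hr, ZeroMemClass.coe_zero]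
  rw [← hz, hz0, map_zero]

theorem pathClass_smul_map_eq {y₀ : V} (hy₀ : ψ y₀ = x) {f : V →ₗ[K] K}
    (hf : f (pathClass π p • y₀) = 1)
    (hker : ∀ y, ψ y ∈ radicalSubmodule Λ U → f (pathClass π p • y) = 0) (y : V) :
    pathClass π p • ψ y = f (pathClass π p • y) • pathClass π p • x := by
  obtain ⟨c, hc⟩ := h.exists_sub_mem_radicalSubmodule hQ hπ (ψ y)
  have hfc : f (pathClass π p • y) = c := by
    have hy := hker (y - c • y₀) (by rwa [map_sub, LinearMap.map_smul_of_tower, hy₀])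
    rwa [smul_sub, smul_comm, map_sub, map_smul f, hf, smul_eq_mul, mul_one, sub_eq_zero] at hy
  have hpc := h.pathClass_smul_eq_zero hQ hπ hc
  rwa [smul_sub, smul_comm, sub_eq_zero, ← hfc] at hpc

theorem isSplitMonomorphism_of_notMem_correctionSubspace {R : Set Λ}
    (hR : IsCopresentedByMast π p U R) (hφψ : ψ ∘ₗ φ = (radicalSubmodule Λ U).subtype) {y₀ : V}
    (hy₀ : ψ y₀ = x) (hmem : pathClass π p • y₀ ∉ correctionSubspace π p R φ ψ) :
    IsSplitMonomorphism φ := by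
  obtain ⟨f, hfy₀, hf⟩ : ∃ f : V →ₗ[K] K, f (pathClass π p • y₀) = 1 ∧
      ∀ z ∈ correctionSubspace π p R φ ψ, f z = 0 := by
    obtain ⟨f, hfy₀, hf⟩ := Submodule.exists_le_ker_of_notMem hmem
    refine ⟨(f (pathClass π p • y₀))⁻¹ • f, inv_mul_cancel₀ hfy₀, fun z hz => ?_⟩
    rw [LinearMap.smul_apply, LinearMap.mem_ker.1 (hf hz), smul_zero]
  obtain ⟨g, hg⟩ := h.exists_linearMap_of_functional hQ f fun τ hτ y =>
    hf _ (hR.smul_mem_correctionSubspace hτ y)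
  have hgφ (z : radicalSubmodule Λ U) : g (φ z) = 0 := by
    refine h.eq_zero_of_terminalPart_smul hQ fun i => ?_
    rw [← vertexIdem_mul_terminalPart hQ, hg, ← map_smul, hf _ (map_mem_correctionSubspace _),
      zero_smul]
  have hψg (y : V) : (ψ - g) y ∈ radicalSubmodule Λ U := by
    have hgy := hg (pathClass π p) y
    rw [vertexIdem_mul_pathClass] at hgy
    rw [h.mem_radicalSubmodule_iff hQ hπ, LinearMap.sub_apply, smul_sub, hgy, sub_eq_zero]
    exact h.pathClass_smul_map_eq hQ hπ hy₀ hfy₀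
      (fun y hy => hf _ (pathClass_smul_mem_correctionSubspace hy)) y
  refine ⟨(ψ - g).codRestrict _ hψg, LinearMap.ext fun z => Subtype.ext ?_⟩
  rw [LinearMap.comp_apply, LinearMap.codRestrict_apply, LinearMap.sub_apply, hgφ, sub_zero]
  exact LinearMap.congr_fun hφψ z

theorem isSplitMonomorphism_or_isSplitEpimorphism (hx : IsPresentedByMast π p x) {R : Set Λ}
    (hspan : ∀ r ∈ Ring.jacobson Λ,
      r * pathClass π p ∈ Submodule.span Λ ((· * pathClass π p) '' R))
    (hR : IsCopresentedByMast π p U R) (hφψ : ψ ∘ₗ φ = (radicalSubmodule Λ U).subtype) :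
    IsSplitMonomorphism φ ∨ IsSplitEpimorphism ψ := by
  by_cases hψ : ∀ y, ψ y ∈ radicalSubmodule Λ U
  · exact Or.inl ⟨ψ.codRestrict _ hψ,
      LinearMap.ext fun z => Subtype.ext (LinearMap.congr_fun hφψ z)⟩
  have hlt : radicalSubmodule Λ U < LinearMap.range ψ := by
    refine SetLike.lt_iff_le_and_exists.2 ⟨fun z hz => ⟨φ ⟨z, hz⟩, ?_⟩, ?_⟩
    · exact LinearMap.congr_fun hφψ ⟨z, hz⟩
    · obtain ⟨y, hy⟩ := not_forall.1 hψ
      exact ⟨ψ y, ⟨y, rfl⟩, hy⟩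
  obtain ⟨y₀, hy₀⟩ := h.mem_of_radicalSubmodule_lt hQ hπ hlt
  by_cases hmem : pathClass π p • y₀ ∈ correctionSubspace π p R φ ψ
  · exact Or.inr (h.isSplitEpimorphism_of_mem_correctionSubspace hQ hπ hx hspan hφψ hy₀ hmem)
  · exact Or.inl (h.isSplitMonomorphism_of_notMem_correctionSubspace hQ hπ hR hφψ hy₀ hmem)

theorem isIrreducibleMap_subtype_radicalSubmodule (hab : a ≠ b) (hx : IsPresentedByMast π p x)
    {R : Set Λ} (hspan : ∀ r ∈ Ring.jacobson Λ,
      r * pathClass π p ∈ Submodule.span Λ ((· * pathClass π p) '' R))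
    (hR : IsCopresentedByMast π p U R) :
    IsIrreducibleMap (radicalSubmodule Λ U).subtype := by
  refine ⟨?_, ?_, ?_⟩
  · rintro ⟨g, hg⟩
    have hpx := smul_mem_radicalSubmodule (pathClass_mem_jacobson hQ hπ p hab) x
    have hgx : (g (pathClass π p • x) : U) = pathClass π p • x :=
      congrArg Subtype.val (LinearMap.congr_fun hg ⟨_, hpx⟩)
    rw [map_smul, Submodule.coe_smul, h.pathClass_smul_eq_zero hQ hπ (g x).2] at hgx
    exact h.smul_ne_zero hgx.symm
  · rintro ⟨g, hg⟩
    have hgx : (g x : U) = x := LinearMap.congr_fun hg x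
    exact h.notMem_radicalSubmodule hQ hπ (hgx ▸ (g x).2)
  · intro V _ _ _ φ ψ hφψ
    let _ : Module K V := Module.compHom V (algebraMap K Λ)
    have : IsScalarTower K Λ V := IsScalarTower.of_algebraMap_smul fun _ _ => rfl
    exact h.isSplitMonomorphism_or_isSplitEpimorphism hQ hπ hx hspan hR hφψ

variable [Module.Finite K Λ]

theorem isIrreducibleMap_subtype_radicalSubmodule_iff (hab : a ≠ b) :
    IsIrreducibleMap (radicalSubmodule Λ U).subtype ↔ IsPresentedByMast π p x ∧
      ∃ R : Set Λ, R ⊆ (Ring.jacobson Λ : Set Λ) ∧ IsBasisModJSq K R (pathClass π p) ∧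
        IsCopresentedByMast π p U R := by
  have : IsNoetherianRing Λ := IsNoetherianRing.of_finite K Λ
  constructor
  · intro hirr
    exact ⟨h.isPresentedByMast_of_isIrreducibleMap hQ hπ hab hirr,
      h.exists_isCopresentedByMast_of_isIrreducibleMap hQ hπ hab hirr⟩
  · rintro ⟨hx, R, -, hbasis, hR⟩
    exact h.isIrreducibleMap_subtype_radicalSubmodule hQ hπ hab hx
      (fun r hr => hbasis.mul_mem_span hr) hR

end IsMastGenerator

end Sufficiency

theorem mainTheorem9_general {K : Type*} [Field K] {Q : Type*} [Quiver Q] [Fintype Q]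
    [∀ a b : Q, Finite (a ⟶ b)] (hQ : QuiverIsAcyclic Q)
    {Λ : Type*} [Ring Λ] [Algebra K Λ] (π : PathAlgebra K Q →ₐ[K] Λ)
    (hπ : Function.Surjective π) {U : Type*} [AddCommGroup U] [Module Λ U]
    {a b : Q} (p : Path a b) (hp : IsMast π p U) :
    IsIrreducibleMap (radicalSubmodule Λ U).subtype ↔
      ¬ IsSimpleModule Λ U ∧ ConditionA π p ∧ ConditionB π p := by
  let _ : Module K U := Module.compHom U (algebraMap K Λ)
  have : IsScalarTower K Λ U := IsScalarTower.of_algebraMap_smul fun _ _ => rfl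
  have : Module.Finite K Λ := moduleFinite_of_surjective hQ hπ
  obtain ⟨x, hx⟩ := hp.exists_isMastGenerator (K := K) hQ hπ
  by_cases hU : IsSimpleModule Λ U
  · exact iff_of_false (fun hirr => hirr.not_isSimpleModule hU) fun h => h.1 hU
  have hab : a ≠ b := fun hab => hU ((hp.isSimpleModule_iff hQ).2 hab)
  rw [hx.isIrreducibleMap_subtype_radicalSubmodule_iff hQ hπ hab, and_iff_right hU,
    conditionB_iff, ← hx.isPresentedByMast_iff_conditionA hQ hπ]
  exact and_congr_right fun hpres => exists_congr fun R => and_congr_right fun _ =>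
    and_congr_right fun hbasis =>
      isCopresentedByMast_iff hx hQ hπ hpres fun r hr => hbasis.mul_ne_zero hr

theorem mainTheorem9 {K : Type*} [Field K] {Q : Type*} [Quiver Q] [Fintype Q]
    [∀ a b : Q, Finite (a ⟶ b)] (hQ : QuiverIsAcyclic Q)
    {Λ : Type*} [Ring Λ] [Algebra K Λ] (π : PathAlgebra K Q →ₐ[K] Λ)
    (hπ : IsAdmissiblePresentation π) (hΛ : IsLeftMultiserial Λ)
    {U : Type*} [AddCommGroup U] [Module Λ U] [Module.Finite Λ U] (hU : IsUniserial Λ U)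
    {a b : Q} (p : Path a b) (hp : IsMast π p U) :
    IsIrreducibleMap (radicalSubmodule Λ U).subtype ↔
      ¬ IsSimpleModule Λ U ∧ ConditionA π p ∧ ConditionB π p :=
  mainTheorem9_general hQ π hπ.1 p hp
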